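/- **Setting.** Fix $L\ge 1$, $\sigma>0$, $\sigma_1,\dots,\sigma_{L+1}>0$, a number of actions $K$, a dimension $d$, and known matrices $W_1,\dots,W_L\in\mathbb R^{d\times d}$. The unknown action parameters $\theta=(\theta_a)_{a\in[K]}$, $\theta_a\in\mathbb R^d$, are drawn from the linear diffusion prior $$\psi_L\sim\mathcal N(0,\sigma_{L+1}^2I_d),\qquad \psi_{\ell-1}\mid\psi_\ell\sim\mathcal N(W_\ell\psi_\ell,\sigma_\ell^2I_d)\ (2\le\ell\le L),\qquad \theta_a\mid\psi_1\sim\mathcal N(W_1\psi_1,\sigma_1^2I_d)\ (a\in[K]),$$ the $\theta_a$ being independent given $\psi_1$. In round $t=1,2,\dots$ the agent observes a context $X_t\in\mathbb R^d$ with $\|X_t\|_2^2=1$, drawn from a probability law that may depend on the history $H_t=(X_i,A_i,Y_i)_{i<t}$ (but not otherwise on $\theta$), takes an action $A_t\in[K]$ and receives $Y_t\sim\mathcal N(X_t^\top\theta_{A_t},\sigma^2)$. Put $r(x,a;\theta)=x^\top\theta_a$. The agent follows diffusion Thompson sampling (dTS): it draws $\psi_{t,L}$ from the posterior $p(\psi_L\mid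 H_t)$, then for $\ell=L,\dots,2$ draws $\psi_{t,\ell-1}$ from $p(\psi_{\ell-1}\mid\psi_\ell=\psi_{t,\ell},H_t)$, then for every $a$ independently draws $\theta_{t,a}$ from $p(\theta_a\mid\psi_1=\psi_{t,1},H_t)$, and plays $A_t\in\arg\max_{a}r(X_t,a;\theta_t)$. With $A_{t,*}\in\arg\max_a r(X_t,a;\theta)$ (ties are broken by the same measurable rule), the Bayes regret over $n$ rounds is $\mathcal{BR}(n)=\mathbb E\big[\sum_{t=1}^n r(X_t,A_{t,*};\theta)-r(X_t,A_t;\theta)\big]$. Assume that for every $\ell\in[L]$ the largest eigenvalue of $W_\ell^\top W_\ell$ is $1$ and that $W_\ell$ is column-sparse: $W_\ell=(\bar W_\ell,\,0_{d,d-d_\ell})$ with $\bar W_\ell\in\mathbb R^{d\times d_\ell}$, $d_\ell\le d$. Let $\sigma_{\max}^2=\max_{\ell\in[L+1]}\big(1+\sigma_\ell^2/\sigma^2\big)$. **Proposition (sparsity).** 1. There is a constant $c>0$, depending only on $K,L,\sigma,\sigma_1,\dots,\sigma_{L+1}$, such that for all $d$, $d_\ell$, $W_\ell$, all context laws as above and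 all $n$, the regret is integrable and, for every $\delta\in(0,1)$, $$\mathcal{BR}(n)\le\sqrt{2n\Big(\mathcal R^{\rm act}(n)+\sum_{\ell=1}^L\tilde{\mathcal R}^{\rm lat}_\ell\Big)\log(1/\delta)}+c\,n\,\delta,$$ where $$\mathcal R^{\rm act}(n)=c_0\,dK\log\Big(1+\frac{n\sigma_1^2}{d}\Big),\quad c_0=\frac{\sigma_1^2}{\log(1+\sigma_1^2)},\qquad \tilde{\mathcal R}^{\rm lat}_\ell=c_\ell\,d_\ell\log\Big(1+\frac{\sigma_{\ell+1}^2}{\sigma_\ell^2}\Big),\quad c_\ell=\frac{\sigma_{\ell+1}^2\,\sigma_{\max}^{2\ell}}{\log(1+\sigma_{\ell+1}^2)}.$$ 2. Consequently $\mathcal{BR}(n)=\tilde{\mathcal O}\Big(\sqrt{n\big(dK\sigma_1^2+\sum_{\ell=1}^L d_\ell\,\sigma_{\ell+1}^2\sigma_{\max}^{2\ell}\big)}\Big)$, in the following sense: there are $C>0$ and $m\in\mathbb N$, depending only on $L,\sigma,\sigma_1,\dots,\sigma_{L+1}$, such that for all $K$, $d$, $d_\ell$, $W_\ell$, all context laws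 as above and all $n\ge1$, $$\mathcal{BR}(n)\le C\,\big(1+\log(nK)\big)^m\sqrt{n\Big(dK\sigma_1^2+\sum_{\ell=1}^L d_\ell\,\sigma_{\ell+1}^2\sigma_{\max}^{2\ell}\Big)}.$$ -/

import Mathlib

open MeasureTheory ProbabilityTheory
open scoped ENNReal NNReal BigOperators

namespace DiffusionTS

noncomputable section

/-- `ℝ^d` with the Euclidean norm. -/
abbrev Vec (d : ℕ) : Type := EuclideanSpace ℝ (Fin d)

/-- One round of interaction: the triple (context, action, reward). -/
abbrev Round (K d : ℕ) : Type := Vec d × Fin K × ℝ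

/-- The history of `t` rounds. -/
abbrev History (K d t : ℕ) : Type := Fin t → Round K d

/-! ### The environment: linear diffusion prior, linear-Gaussian rewards

The mixing matrices `W ℓ` and the standard deviations `s ℓ` carry the index `ℓ = 1, 2, …`
of the layers; the values at the index `0` are never used. -/

/-- The law `N(W_ℓ ψ, s_ℓ² I_d)`: for `ℓ = 1` the law of an action parameter `θ_a` given `ψ_1 = ψ`,
for `ℓ ≥ 2` the law of `ψ_{ℓ-1}` given `ψ_ℓ = ψ`. -/
def linkDist {d : ℕ} (W : ℕ → Matrix (Fin d) (Fin d) ℝ) (s : ℕ → ℝ) (ℓ : ℕ) (ψ : Vec d) :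
    Measure (Vec d) :=
  multivariateGaussian (Matrix.toEuclideanCLM (𝕜 := ℝ) (W ℓ) ψ)
    ((s ℓ ^ 2) • (1 : Matrix (Fin d) (Fin d) ℝ))

/-- The law `N(0, s_{L+1}² I_d)` of the top latent parameter `ψ_L`. -/
def topDist (d : ℕ) (s : ℕ → ℝ) (L : ℕ) : Measure (Vec d) :=
  multivariateGaussian 0 ((s (L + 1) ^ 2) • (1 : Matrix (Fin d) (Fin d) ℝ))

/-- `thetaGivenLatent W s j ψ` is the law of `(θ_a)_a` given `ψ_{j+1} = ψ`: descend the layers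
`ψ_j, …, ψ_1`, then draw the `θ_a` independently given `ψ_1`. -/
def thetaGivenLatent {K d : ℕ} (W : ℕ → Matrix (Fin d) (Fin d) ℝ) (s : ℕ → ℝ) :
    ℕ → Vec d → Measure (Fin K → Vec d)
  | 0, ψ => Measure.pi fun _ => linkDist W s 1 ψ
  | j + 1, ψ => (linkDist W s (j + 2) ψ).bind (thetaGivenLatent W s j)

/-- The law of the action parameters `(θ_a)_a` under the diffusion prior of depth `L ≥ 1`. -/
def prior {K d : ℕ} (L : ℕ) (W : ℕ → Matrix (Fin d) (Fin d) ℝ) (s : ℕ → ℝ) :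
    Measure (Fin K → Vec d) :=
  (topDist d s L).bind (thetaGivenLatent W s (L - 1))

/-- The reward distribution `N(xᵀ θ_a, σ²)`. -/
def rewardDist {d : ℕ} (σ : ℝ) (x θa : Vec d) : Measure ℝ :=
  gaussianReal (inner ℝ x θa) (σ ^ 2).toNNReal

/-- The expected reward `r(x, a; θ)`. -/
def meanReward {K d : ℕ} (σ : ℝ) (x : Vec d) (a : Fin K) (θ : Fin K → Vec d) : ℝ :=
  ∫ y, y ∂(rewardDist σ x (θ a))

/-- `sel x θ` is, measurably in `(x, θ)`, an action maximizing `r(x, ·; θ)`. -/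
def IsArgmax {K d : ℕ} (σ : ℝ) (sel : Vec d → (Fin K → Vec d) → Fin K) : Prop :=
  Measurable (Function.uncurry sel) ∧
    ∀ x θ a, meanReward σ x a θ ≤ meanReward σ x (sel x θ) θ

/-! ### Diffusion Thompson sampling -/

/-- Bayes' rule: the probability measure proportional to `f · μ`. -/
def bayes {α : Type*} [MeasurableSpace α] (μ : Measure α) (f : α → ℝ≥0∞) : Measure α :=
  (∫⁻ x, f x ∂μ)⁻¹ • μ.withDensity f

/-- The likelihood `∏_{i : A_i = a} P(Y_i | X_i; θ_a)` of the interactions with action `a`. -/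
def actionLik {K d t : ℕ} (σ : ℝ) (h : History K d t) (a : Fin K) (θa : Vec d) : ℝ≥0∞ :=
  ∏ i ∈ Finset.univ.filter (fun i => (h i).2.1 = a),
    gaussianPDF (inner ℝ (h i).1 θa) (σ ^ 2).toNNReal (h i).2.2

/-- `latentLik W s σ h j ψ` is the likelihood `p(h | ψ_{j+1} = ψ)`, computed recursively. -/
def latentLik {K d t : ℕ} (W : ℕ → Matrix (Fin d) (Fin d) ℝ) (s : ℕ → ℝ) (σ : ℝ)
    (h : History K d t) : ℕ → Vec d → ℝ≥0∞
  | 0, ψ => ∏ a, ∫⁻ θa, actionLik σ h a θa ∂(linkDist W s 1 ψ)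
  | j + 1, ψ => ∫⁻ ψ', latentLik W s σ h j ψ' ∂(linkDist W s (j + 2) ψ)

/-- `dtsGivenLatent W s σ h j ψ` is the law of the sampled `(θ_{t,a})_a` once the algorithm has
drawn `ψ_{t,j+1} = ψ`: draw `ψ_{t,j}, …, ψ_{t,1}` successively from the conditional latent
posteriors, then the `θ_{t,a}` independently from the conditional action posteriors. -/
def dtsGivenLatent {K d t : ℕ} (W : ℕ → Matrix (Fin d) (Fin d) ℝ) (s : ℕ → ℝ) (σ : ℝ)
    (h : History K d t) : ℕ → Vec d → Measure (Fin K → Vec d)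
  | 0, ψ => Measure.pi fun a => bayes (linkDist W s 1 ψ) (actionLik σ h a)
  | j + 1, ψ =>
      (bayes (linkDist W s (j + 2) ψ) (latentLik W s σ h j)).bind (dtsGivenLatent W s σ h j)

/-- The law of the parameters `θ_t` that diffusion Thompson sampling draws after the history `h`:
draw `ψ_{t,L}` from its posterior, then descend the layers. -/
def dtsSample {K d t : ℕ} (L : ℕ) (W : ℕ → Matrix (Fin d) (Fin d) ℝ) (s : ℕ → ℝ) (σ : ℝ)
    (h : History K d t) : Measure (Fin K → Vec d) :=
  (bayes (topDist d s L) (latentLik W s σ h (L - 1))).bind (dtsGivenLatent W s σ h (L - 1))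

/-! ### The interaction and its Bayes regret -/

/-- The joint law of the action parameters and of one round, played after the history `p.2`
by diffusion Thompson sampling when the parameters are `p.1`; the extended history is returned.
The context is drawn from `ctx`, given the past observations only. -/
def nextRound {K d t : ℕ} (L : ℕ) (W : ℕ → Matrix (Fin d) (Fin d) ℝ) (s : ℕ → ℝ) (σ : ℝ)
    (ctx : Kernel (History K d t) (Vec d)) (sel : Vec d → (Fin K → Vec d) → Fin K)
    (p : (Fin K → Vec d) × History K d t) : Measure ((Fin K → Vec d) × History K d (t + 1)) :=
  (ctx p.2).bind fun x =>
    (dtsSample L W s σ p.2).bind fun θt =>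
      (rewardDist σ x (p.1 (sel x θt))).map fun y =>
        (p.1, Fin.snoc (α := fun _ => Round K d) p.2 (x, sel x θt, y))

/-- The joint law of the action parameters, drawn from the prior, and of the first `n` rounds. -/
def law {K d : ℕ} (L : ℕ) (W : ℕ → Matrix (Fin d) (Fin d) ℝ) (s : ℕ → ℝ) (σ : ℝ)
    (ctx : (t : ℕ) → Kernel (History K d t) (Vec d)) (sel : Vec d → (Fin K → Vec d) → Fin K) :
    (n : ℕ) → Measure ((Fin K → Vec d) × History K d n)
  | 0 => (prior L W s).map fun θ => (θ, Fin.elim0)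
  | t + 1 => (law L W s σ ctx sel t).bind (nextRound L W s σ (ctx t) sel)

/-- The regret `∑_t r(X_t, A_{t,*}; θ) - r(X_t, A_t; θ)` of a history under the parameters `θ`. -/
def regret {K d n : ℕ} (σ : ℝ) (sel : Vec d → (Fin K → Vec d) → Fin K)
    (p : (Fin K → Vec d) × History K d n) : ℝ :=
  ∑ t, (meanReward σ (p.2 t).1 (sel (p.2 t).1 p.1) p.1 - meanReward σ (p.2 t).1 (p.2 t).2.1 p.1)

/-- The Bayes regret of diffusion Thompson sampling over `n` rounds. -/
def bayesRegret {K d : ℕ} (L : ℕ) (W : ℕ → Matrix (Fin d) (Fin d) ℝ) (s : ℕ → ℝ) (σ : ℝ)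
    (ctx : (t : ℕ) → Kernel (History K d t) (Vec d)) (sel : Vec d → (Fin K → Vec d) → Fin K)
    (n : ℕ) : ℝ :=
  ∫ p, regret σ sel p ∂(law L W s σ ctx sel n)

/-! ### Quantities in the bound and assumptions -/

/-- `σ_max² = max_{1 ≤ ℓ ≤ L+1} (1 + σ_ℓ² / σ²)`. -/
def sigmaMaxSq (L : ℕ) (s : ℕ → ℝ) (σ : ℝ) : ℝ :=
  (Finset.Icc 1 (L + 1)).sup' (Finset.nonempty_Icc.mpr (Nat.le_add_left 1 L))
    fun ℓ => 1 + s ℓ ^ 2 / σ ^ 2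

/-- The action term `c_0 d K log(1 + n σ_1² / d)` with `c_0 = σ_1² / log(1 + σ_1²)`. -/
def actTerm (K d n : ℕ) (s : ℕ → ℝ) : ℝ :=
  s 1 ^ 2 / Real.log (1 + s 1 ^ 2) * d * K * Real.log (1 + n * s 1 ^ 2 / d)

/-- The latent term `c_ℓ d_ℓ log(1 + σ_{ℓ+1}² / σ_ℓ²)` with
`c_ℓ = σ_{ℓ+1}² σ_max^{2ℓ} / log(1 + σ_{ℓ+1}²)`. -/
def latTerm (L : ℕ) (s : ℕ → ℝ) (σ : ℝ) (dl : ℕ → ℕ) (ℓ : ℕ) : ℝ :=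
  s (ℓ + 1) ^ 2 * sigmaMaxSq L s σ ^ ℓ / Real.log (1 + s (ℓ + 1) ^ 2) * dl ℓ *
    Real.log (1 + s (ℓ + 1) ^ 2 / s ℓ ^ 2)

/-- The largest eigenvalue of `Wᵀ W` is `1`. -/
def TopEigenvalueOne {d : ℕ} (W : Matrix (Fin d) (Fin d) ℝ) : Prop :=
  IsGreatest {l : ℝ | Module.End.HasEigenvalue (Matrix.toLin' (W.transpose * W)) l} 1

/-- `W = (W̄, 0)` with `W̄` of size `d × m`, where `m ≤ d`. -/
def ColumnSparse {d : ℕ} (m : ℕ) (W : Matrix (Fin d) (Fin d) ℝ) : Prop :=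
  m ≤ d ∧ ∃ Wbar : Matrix (Fin d) (Fin m) ℝ,
    ∀ i j, W i j = if hj : j.val < m then Wbar i ⟨j.val, hj⟩ else 0

end

/-! ### Well-posedness

All the maps into measures used above are measurable with probability values, so that `bayes`
normalizes a finite nonzero measure, `Measure.bind` is the genuine composition, and `law` is a
probability measure. -/

section WellPosed

lemma measurable_bind_uncurry {α β γ : Type*} [MeasurableSpace α] [MeasurableSpace β]
    [MeasurableSpace γ] {m : α → Measure β} (hm : Measurable m) [∀ a, IsProbabilityMeasure (m a)]
    {g : α → β → Measure γ} (hg : Measurable (Function.uncurry g)) :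
    Measurable fun a => (m a).bind (g a) := by
  refine Measure.measurable_of_measurable_coe _ fun S hS => ?_
  have hga : ∀ a, Measurable (g a) := fun a => hg.of_uncurry_left
  simp_rw [fun a => Measure.bind_apply hS (hga a).aemeasurable]
  let κ : Kernel α β := ⟨m, hm⟩
  have : IsMarkovKernel κ := ⟨fun a => by change IsProbabilityMeasure (m a); infer_instance⟩
  exact Measurable.lintegral_kernel_prod_right (κ := κ) (f := fun a b => g a b S)
    ((Measure.measurable_coe hS).comp hg)

lemma isProb_bind {α β : Type*} [MeasurableSpace α] [MeasurableSpace β]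
    (m : Measure α) [IsProbabilityMeasure m] {g : α → Measure β} (hg : Measurable g)
    [∀ a, IsProbabilityMeasure (g a)] : IsProbabilityMeasure (m.bind g) :=
  ⟨by rw [Measure.bind_apply MeasurableSet.univ hg.aemeasurable]; simp⟩

lemma measurable_map_uncurry {α β γ : Type*} [MeasurableSpace α] [MeasurableSpace β]
    [MeasurableSpace γ] {m : α → Measure β} (hm : Measurable m) [∀ a, IsProbabilityMeasure (m a)]
    {g : α → β → γ} (hg : Measurable (Function.uncurry g)) :
    Measurable fun a => (m a).map (g a) := by
  have h : ∀ a, (m a).map (g a) = (m a).bind fun b => Measure.dirac (g a b) := fun a =>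
    (Measure.bind_dirac_eq_map (m a) hg.of_uncurry_left).symm
  simp_rw [h]
  exact measurable_bind_uncurry hm (g := fun a b => Measure.dirac (g a b))
    (Measure.measurable_dirac.comp hg)

lemma measurable_pi_measure {α ι β : Type*} [Fintype ι] [MeasurableSpace α] [MeasurableSpace β]
    {m : ι → α → Measure β} (hm : ∀ i, Measurable (m i))
    [∀ i a, IsProbabilityMeasure (m i a)] :
    Measurable fun a => Measure.pi fun i => m i a := by
  refine Measurable.measure_of_isPiSystem_of_isProbabilityMeasure generateFrom_pi.symm
    isPiSystem_pi ?_
  rintro _ ⟨S, hS, rfl⟩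
  simp_rw [Measure.pi_pi]
  exact Finset.measurable_prod _ fun i _ =>
    (Measure.measurable_coe (hS i (Set.mem_univ i))).comp (hm i)

lemma measurable_lintegral_uncurry {α β : Type*} [MeasurableSpace α] [MeasurableSpace β]
    {m : α → Measure β} (hm : Measurable m) [∀ a, IsProbabilityMeasure (m a)]
    {f : α → β → ℝ≥0∞} (hf : Measurable (Function.uncurry f)) :
    Measurable fun a => ∫⁻ b, f a b ∂(m a) := by
  let κ : Kernel α β := ⟨m, hm⟩
  have : IsMarkovKernel κ := ⟨fun a => by change IsProbabilityMeasure (m a); infer_instance⟩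
  exact Measurable.lintegral_kernel_prod_right (κ := κ) hf

lemma measurable_bayes {α β : Type*} [MeasurableSpace α] [MeasurableSpace β]
    {m : α → Measure β} (hm : Measurable m) [∀ a, IsProbabilityMeasure (m a)]
    {f : α → β → ℝ≥0∞} (hf : Measurable (Function.uncurry f)) :
    Measurable fun a => bayes (m a) (f a) := by
  refine Measure.measurable_of_measurable_coe _ fun S hS => ?_
  simp only [bayes, Measure.smul_apply, smul_eq_mul]
  refine (measurable_lintegral_uncurry hm hf).inv.mul ?_
  simp_rw [withDensity_apply _ hS, ← lintegral_indicator hS]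
  refine measurable_lintegral_uncurry hm (f := fun a => S.indicator (f a)) ?_
  have : Function.uncurry (fun a => S.indicator (f a))
      = (Prod.snd ⁻¹' S).indicator (Function.uncurry f) := by
    ext ⟨a, b⟩; rfl
  rw [this]
  exact hf.indicator (measurable_snd hS)

lemma isProb_bayes {α : Type*} [MeasurableSpace α] (m : Measure α)
    {f : α → ℝ≥0∞} (h0 : ∫⁻ x, f x ∂m ≠ 0) (h1 : ∫⁻ x, f x ∂m ≠ ∞) :
    IsProbabilityMeasure (bayes m f) :=
  ⟨by simp [bayes, ENNReal.inv_mul_cancel h0 h1]⟩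

/-- `f` takes values in `(0, C]` for some finite `C`. -/
def Tame {α : Type*} (f : α → ℝ≥0∞) : Prop := (∀ x, f x ≠ 0) ∧ ∃ C : ℝ≥0∞, C ≠ ∞ ∧ ∀ x, f x ≤ C

lemma Tame.lintegral {α β : Type*} [MeasurableSpace β] {m : α → Measure β}
    [∀ a, IsProbabilityMeasure (m a)] {f : β → ℝ≥0∞} (hf : Tame f) (hm : Measurable f) :
    Tame fun a => ∫⁻ b, f b ∂(m a) := by
  obtain ⟨h0, C, hC, hle⟩ := hf
  refine ⟨fun a h => ?_, C, hC, fun a => ?_⟩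
  · rw [lintegral_eq_zero_iff hm] at h
    obtain ⟨x, hx⟩ := h.exists
    exact h0 x hx
  · calc ∫⁻ b, f b ∂(m a) ≤ ∫⁻ _, C ∂(m a) := lintegral_mono hle
      _ = C := by simp

lemma Tame.prod {α ι : Type*} (T : Finset ι) {f : ι → α → ℝ≥0∞} (hf : ∀ i, Tame (f i)) :
    Tame fun x => ∏ i ∈ T, f i x := by
  choose h0 C hC hle using hf
  refine ⟨fun x => Finset.prod_ne_zero_iff.mpr fun i _ => h0 i x, ∏ i ∈ T, C i,
    ENNReal.prod_ne_top fun i _ => hC i, fun x => Finset.prod_le_prod' fun i _ => hle i x⟩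

lemma Tame.isProb_bayes {α : Type*} [MeasurableSpace α] (m : Measure α) [IsProbabilityMeasure m]
    {f : α → ℝ≥0∞} (hf : Tame f) (hm : Measurable f) : IsProbabilityMeasure (bayes m f) := by
  obtain ⟨h0, C, hC, hle⟩ := hf.lintegral (m := fun _ : Unit => m) hm
  exact DiffusionTS.isProb_bayes m (h0 ()) (ne_top_of_le_ne_top hC (hle ()))

variable {K d t : ℕ} (L : ℕ) (W : ℕ → Matrix (Fin d) (Fin d) ℝ) (s : ℕ → ℝ) (σ : ℝ)

instance (ℓ : ℕ) (ψ : Vec d) : IsProbabilityMeasure (linkDist W s ℓ ψ) := by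
  unfold linkDist; infer_instance

instance : IsProbabilityMeasure (topDist d s L) := by
  unfold topDist; infer_instance

open scoped MatrixOrder in
lemma measurable_linkDist (ℓ : ℕ) : Measurable (linkDist W s ℓ) := by
  unfold linkDist multivariateGaussian
  exact measurable_map_uncurry (m := fun _ : Vec d => stdGaussian (Vec d)) measurable_const
    (g := fun ψ x => Matrix.toEuclideanCLM (𝕜 := ℝ) (W ℓ) ψ +
      Matrix.toEuclideanCLM (𝕜 := ℝ) (CFC.sqrt ((s ℓ ^ 2) • 1)) x) (by fun_prop)

lemma thetaGivenLatent_good (j : ℕ) : Measurable (thetaGivenLatent (K := K) W s j) ∧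
    ∀ ψ, IsProbabilityMeasure (thetaGivenLatent (K := K) W s j ψ) := by
  induction j with
  | zero =>
    refine ⟨measurable_pi_measure (fun _ => measurable_linkDist W s 1), fun ψ => ?_⟩
    simp only [thetaGivenLatent]; infer_instance
  | succ j ih =>
    have := ih.2
    exact ⟨(Measure.measurable_bind' ih.1).comp (measurable_linkDist W s (j + 2)),
      fun ψ => isProb_bind _ ih.1⟩

instance : IsProbabilityMeasure (prior (K := K) L W s) := by
  have h := thetaGivenLatent_good (K := K) W s (L - 1)
  have := h.2
  exact isProb_bind _ h.1

lemma measurable_actionLik (a : Fin K) :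
    Measurable fun p : History K d t × Vec d => actionLik σ p.1 a p.2 := by
  classical
  have h : (fun p : History K d t × Vec d => actionLik σ p.1 a p.2) = fun p =>
      ∏ i, if (p.1 i).2.1 = a then
        gaussianPDF (inner ℝ (p.1 i).1 p.2) (σ ^ 2).toNNReal (p.1 i).2.2 else 1 := by
    ext p; rw [actionLik, Finset.prod_filter]
  rw [h]
  refine Finset.measurable_prod _ fun i _ => Measurable.ite ?_ ?_ measurable_const
  · exact (measurableSet_singleton a).preimage
      (f := fun p : History K d t × Vec d => (p.1 i).2.1) (by fun_prop)
  · have h := measurable_uncurry_gaussianPDFReal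
    exact (h.comp (f := fun p : History K d t × Vec d =>
      ((inner ℝ (p.1 i).1 p.2 : ℝ), (σ ^ 2).toNNReal, (p.1 i).2.2)) (by fun_prop)).ennreal_ofReal

lemma measurable_actionLik' (h : History K d t) (a : Fin K) : Measurable (actionLik σ h a) :=
  Measurable.of_uncurry_left (f := fun (h : History K d t) θa => actionLik σ h a θa)
    (measurable_actionLik σ a)

lemma tame_actionLik (hσ : 0 < σ) (h : History K d t) (a : Fin K) : Tame (actionLik σ h a) := by
  have hv : (σ ^ 2).toNNReal ≠ 0 := by simpa using hσ.ne'
  refine Tame.prod _ (f := fun i θa => gaussianPDF (inner ℝ (h i).1 θa) (σ ^ 2).toNNReal (h i).2.2)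
    fun i => ⟨fun x => (gaussianPDF_pos _ hv _).ne',
      ENNReal.ofReal (Real.sqrt (2 * Real.pi * (σ ^ 2).toNNReal))⁻¹, ENNReal.ofReal_ne_top,
      fun x => ENNReal.ofReal_le_ofReal ?_⟩
  rw [gaussianPDFReal]
  refine mul_le_of_le_one_right (by positivity) (Real.exp_le_one_iff.mpr ?_)
  rw [neg_div]
  exact neg_nonpos.mpr (by positivity)

lemma measurable_latentLik (j : ℕ) :
    Measurable fun p : History K d t × Vec d => latentLik W s σ p.1 j p.2 := by
  induction j with
  | zero =>
    refine Finset.measurable_prod _ fun a _ => ?_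
    exact measurable_lintegral_uncurry (m := fun p : History K d t × Vec d => linkDist W s 1 p.2)
      ((measurable_linkDist W s 1).comp measurable_snd) (f := fun p θa => actionLik σ p.1 a θa)
      ((measurable_actionLik σ a).comp (f := fun q : (History K d t × Vec d) × Vec d =>
        (q.1.1, q.2)) (by fun_prop))
  | succ j ih =>
    exact measurable_lintegral_uncurry
      (m := fun p : History K d t × Vec d => linkDist W s (j + 2) p.2)
      ((measurable_linkDist W s (j + 2)).comp measurable_snd)
      (f := fun p ψ' => latentLik W s σ p.1 j ψ')
      (ih.comp (f := fun q : (History K d t × Vec d) × Vec d => (q.1.1, q.2)) (by fun_prop))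

lemma measurable_latentLik' (h : History K d t) (j : ℕ) : Measurable (latentLik W s σ h j) :=
  Measurable.of_uncurry_left (f := fun (h : History K d t) ψ => latentLik W s σ h j ψ)
    (measurable_latentLik W s σ j)

lemma tame_latentLik (hσ : 0 < σ) (h : History K d t) (j : ℕ) : Tame (latentLik W s σ h j) := by
  induction j with
  | zero =>
    exact Tame.prod Finset.univ (f := fun a ψ => ∫⁻ θa, actionLik σ h a θa ∂(linkDist W s 1 ψ))
      fun a => (tame_actionLik σ hσ h a).lintegral
        (measurable_actionLik' σ _ a)
  | succ j ih =>
    exact ih.lintegral (m := linkDist W s (j + 2))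
      (measurable_latentLik' W s σ _ j)

lemma dtsGivenLatent_good (hσ : 0 < σ) (j : ℕ) :
    Measurable (fun p : History K d t × Vec d => dtsGivenLatent W s σ p.1 j p.2) ∧
    ∀ p : History K d t × Vec d, IsProbabilityMeasure (dtsGivenLatent W s σ p.1 j p.2) := by
  have hl : ∀ ℓ, Measurable fun p : History K d t × Vec d => linkDist W s ℓ p.2 := fun ℓ =>
    (measurable_linkDist W s ℓ).comp measurable_snd
  have hr : Measurable fun q : (History K d t × Vec d) × Vec d => (q.1.1, q.2) :=
    measurable_fst.fst.prodMk measurable_snd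
  induction j with
  | zero =>
    let m : Fin K → History K d t × Vec d → Measure (Vec d) := fun a p =>
      bayes (linkDist W s 1 p.2) (actionLik σ p.1 a)
    have hm : ∀ a, Measurable (m a) := fun a => by
      have h2 : Measurable (Function.uncurry fun (p : History K d t × Vec d) (θa : Vec d) =>
        actionLik σ p.1 a θa) := (measurable_actionLik σ a).comp
          (f := fun q : (History K d t × Vec d) × Vec d => (q.1.1, q.2)) hr
      exact measurable_bayes (m := fun p : History K d t × Vec d => linkDist W s 1 p.2) (hl 1)
        (f := fun p θa => actionLik σ p.1 a θa) h2
    have hp : ∀ a p, IsProbabilityMeasure (m a p) := fun a p =>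
      (tame_actionLik σ hσ p.1 a).isProb_bayes _
        (measurable_actionLik' σ _ a)
    have e : (fun p : History K d t × Vec d => dtsGivenLatent W s σ p.1 0 p.2)
        = fun p => Measure.pi fun a => m a p := by
      funext p; rw [dtsGivenLatent]
    refine ⟨?_, fun p => ?_⟩
    · rw [e]; exact measurable_pi_measure hm
    · rw [congrFun e p]; infer_instance
  | succ j ih =>
    let m : History K d t × Vec d → Measure (Vec d) := fun p =>
      bayes (linkDist W s (j + 2) p.2) (latentLik W s σ p.1 j)
    have hm : Measurable m := by
      have h2 : Measurable (Function.uncurry fun (p : History K d t × Vec d) (ψ : Vec d) =>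
        latentLik W s σ p.1 j ψ) := (measurable_latentLik W s σ j).comp
          (f := fun q : (History K d t × Vec d) × Vec d => (q.1.1, q.2)) hr
      exact measurable_bayes (m := fun p : History K d t × Vec d => linkDist W s (j + 2) p.2)
        (hl (j + 2)) (f := fun p ψ => latentLik W s σ p.1 j ψ) h2
    have hp : ∀ p, IsProbabilityMeasure (m p) := fun p =>
      (tame_latentLik W s σ hσ p.1 j).isProb_bayes _
        (measurable_latentLik' W s σ _ j)
    let g : History K d t × Vec d → Vec d → Measure (Fin K → Vec d) := fun p ψ =>
      dtsGivenLatent W s σ p.1 j ψ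
    have hg : Measurable (Function.uncurry g) := ih.1.comp
      (f := fun q : (History K d t × Vec d) × Vec d => (q.1.1, q.2)) hr
    have hgp : ∀ p ψ, IsProbabilityMeasure (g p ψ) := fun p ψ => ih.2 (p.1, ψ)
    have e : (fun p : History K d t × Vec d => dtsGivenLatent W s σ p.1 (j + 1) p.2)
        = fun p => (m p).bind (g p) := by
      funext p; rw [dtsGivenLatent]
    refine ⟨?_, fun p => ?_⟩
    · rw [e]; exact measurable_bind_uncurry hm hg
    · rw [congrFun e p]
      exact isProb_bind _ hg.of_uncurry_left

lemma dtsSample_good (hσ : 0 < σ) :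
    Measurable (fun h : History K d t => dtsSample L W s σ h) ∧
    ∀ h : History K d t, IsProbabilityMeasure (dtsSample L W s σ h) := by
  have hg := dtsGivenLatent_good (K := K) (t := t) W s σ hσ (L - 1)
  have hp : ∀ h : History K d t,
      IsProbabilityMeasure (bayes (topDist d s L) (latentLik W s σ h (L - 1))) := fun h =>
    (tame_latentLik W s σ hσ h _).isProb_bayes _
      (measurable_latentLik' W s σ _ _)
  refine ⟨?_, fun h => ?_⟩
  · exact measurable_bind_uncurry
      (m := fun h : History K d t => bayes (topDist d s L) (latentLik W s σ h (L - 1)))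
      (measurable_bayes measurable_const (measurable_latentLik W s σ _))
      (g := fun h => dtsGivenLatent W s σ h (L - 1)) hg.1
  · have := hp h
    have := fun ψ => hg.2 (h, ψ)
    exact isProb_bind _ (hg.1.comp measurable_prodMk_left)

lemma measurable_snoc : Measurable fun q : History K d t × Round K d =>
    (Fin.snoc (α := fun _ => Round K d) q.1 q.2 : History K d (t + 1)) := by
  refine measurable_pi_iff.mpr fun i => ?_
  refine Fin.lastCases ?_ (fun j => ?_) i
  · simpa using measurable_snd
  · simp only [Fin.snoc_castSucc]
    fun_prop

lemma measurable_gaussianReal_mean (v : ℝ≥0) :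
    Measurable fun μ : ℝ => gaussianReal μ v := by
  have h : ∀ μ : ℝ, gaussianReal μ v = (gaussianReal 0 v).map (μ + ·) := fun μ => by
    rw [gaussianReal_map_const_add, zero_add]
  rw [funext h]
  exact measurable_map_uncurry (m := fun _ : ℝ => gaussianReal 0 v) measurable_const
    (g := fun μ y => μ + y) (by fun_prop)

lemma measurable_apply_sel {α : Type*} [MeasurableSpace α] {f : α → Fin K → Vec d}
    (hf : Measurable f) {k : α → Fin K} (hk : Measurable k) : Measurable fun a => f a (k a) := by
  have h : Measurable fun r : Fin K × (Fin K → Vec d) => r.2 r.1 :=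
    measurable_from_prod_countable_right fun i => measurable_pi_apply i
  exact h.comp (hk.prodMk hf)

lemma nextRound_good (hσ : 0 < σ) (ctx : Kernel (History K d t) (Vec d)) [IsMarkovKernel ctx]
    {sel : Vec d → (Fin K → Vec d) → Fin K} (hsel : Measurable (Function.uncurry sel)) :
    Measurable (nextRound L W s σ ctx sel) ∧
    ∀ p, IsProbabilityMeasure (nextRound L W s σ ctx sel p) := by
  have hs := dtsSample_good (K := K) (t := t) L W s σ hσ
  have := hs.2
  have hrp : ∀ x θa : Vec d, IsProbabilityMeasure (rewardDist σ x θa) := fun x θa => by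
    unfold rewardDist; infer_instance
  let F : (((Fin K → Vec d) × History K d t) × Vec d) → (Fin K → Vec d) →
      Measure ((Fin K → Vec d) × History K d (t + 1)) := fun q θt =>
    (rewardDist σ q.2 (q.1.1 (sel q.2 θt))).map fun y =>
      (q.1.1, Fin.snoc (α := fun _ => Round K d) q.1.2 (q.2, sel q.2 θt, y))
  have hsn : ∀ q θt, Measurable fun y : ℝ => ((q : ((Fin K → Vec d) × History K d t) × Vec d).1.1,
      (Fin.snoc (α := fun _ => Round K d) q.1.2 (q.2, sel q.2 θt, y) : History K d (t + 1))) :=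
    fun q θt => measurable_const.prodMk (measurable_snoc.comp
      (measurable_const.prodMk (measurable_const.prodMk (measurable_const.prodMk measurable_id))))
  have hFp : ∀ q θt, IsProbabilityMeasure (F q θt) := fun q θt =>
    Measure.isProbabilityMeasure_map (hsn q θt).aemeasurable
  have hFm : Measurable (Function.uncurry F) := by
    have hk : Measurable fun r : (((Fin K → Vec d) × History K d t) × Vec d) × (Fin K → Vec d) =>
        sel r.1.2 r.2 := hsel.comp (measurable_fst.snd.prodMk measurable_snd)
    have hm : Measurable fun r : (((Fin K → Vec d) × History K d t) × Vec d) × (Fin K → Vec d) =>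
        rewardDist σ r.1.2 (r.1.1.1 (sel r.1.2 r.2)) := by
      have := measurable_apply_sel (f := fun r : (((Fin K → Vec d) × History K d t) × Vec d) ×
        (Fin K → Vec d) => r.1.1.1) (by fun_prop) hk
      exact (measurable_gaussianReal_mean _).comp (measurable_fst.snd.inner this)
    refine measurable_map_uncurry hm (g := fun r y => (r.1.1.1,
      (Fin.snoc (α := fun _ => Round K d) r.1.1.2 (r.1.2, sel r.1.2 r.2, y) :
        History K d (t + 1)))) ?_
    exact measurable_fst.fst.fst.fst.prodMk (measurable_snoc.comp
      (measurable_fst.fst.fst.snd.prodMk (measurable_fst.fst.snd.prodMk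
        ((hk.comp measurable_fst).prodMk measurable_snd))))
  let G : ((Fin K → Vec d) × History K d t) → Vec d →
      Measure ((Fin K → Vec d) × History K d (t + 1)) := fun p x =>
    (dtsSample L W s σ p.2).bind (F (p, x))
  have hGm : Measurable (Function.uncurry G) :=
    measurable_bind_uncurry (m := fun q : ((Fin K → Vec d) × History K d t) × Vec d =>
      dtsSample L W s σ q.1.2) (hs.1.comp measurable_fst.snd) (g := F) hFm
  have hGp : ∀ p x, IsProbabilityMeasure (G p x) := fun p x =>
    isProb_bind _ (hFm.of_uncurry_left (x := (p, x)))
  exact ⟨measurable_bind_uncurry (m := fun p : (Fin K → Vec d) × History K d t => ctx p.2)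
    (ctx.measurable.comp measurable_snd) (g := G) hGm,
    fun p => isProb_bind _ (hGm.of_uncurry_left (x := p))⟩

/-- The interaction is well posed: `law` is a probability measure. -/
theorem isProbabilityMeasure_law (hσ : 0 < σ) (ctx : (t : ℕ) → Kernel (History K d t) (Vec d))
    (hctx : ∀ t, IsMarkovKernel (ctx t)) {sel : Vec d → (Fin K → Vec d) → Fin K}
    (hsel : Measurable (Function.uncurry sel)) (n : ℕ) :
    IsProbabilityMeasure (law L W s σ ctx sel n) := by
  induction n with
  | zero =>
    exact Measure.isProbabilityMeasure_map (measurable_id.prodMk measurable_const).aemeasurable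
  | succ t ih =>
    have := hctx t
    have h := nextRound_good L W s σ hσ (ctx t) hsel
    have := h.2
    exact isProb_bind _ h.1

end WellPosed

end DiffusionTS

/-!
The proof is Bayesian. Composing Bayes' rule along the layers shows that diffusion Thompson sampling
draws exactly from the posterior of the action parameters (`dtsSample_eq`), so that, given the
history, the true parameters `θ` and the sampled parameters `θt` are independent and identically
distributed (`lintegral_law_eq_lintegral_posterior`, `lintegral_law_succ_round`).

The prior is the image of standard Gaussian noise under a linear map. Since the matrices `W ℓ` are
contractions, the parameter of each arm has prior variance at most `C = ∑ s_ℓ²` in every direction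
(`prior_eq_map_noise`). By the Cameron–Martin formula for the noise, the expected reward
`⟨x, θ_a⟩` has under the posterior the moment generating function of a Gaussian law. Its variance is
at most `v = C xᵀ V_a⁻¹ x`, where `V_a = 1 + (C / σ²) ∑ X_i X_iᵀ`, the sum being over the rounds in
which `a` was played (`exists_posterior_mgf`, `le_varBound`).

In one round, exchanging `θ` and `θt` turns the expected regret into the mean of
`D_{a*} = ⟨x, θ_{a*} - θt_{a*}⟩`, where `a*` is optimal for `θ`. As `exp (l D_a - l² v_a)` has mean
at most `1` for each arm, `𝔼 D_{a*} ≤ l 𝔼 v_{a*} + (1 + log K) / l`, and `a*` has the law of the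
action played (`lintegral_regret_le`). By the matrix determinant lemma, `v` is at most `σ² + C`
times the increase of the potential `∑_a log det V_a`, which after `n` rounds is at most
`K d log (1 + n C / (d σ²))`. Summing over the rounds, by induction on `n`, and optimizing `l` gives
`BR(n) ≤ 2 √(n (1 + log K) (σ² + C) K d log (1 + n C / (d σ²)))` (`bayesRegret_le_two_mul_sqrt`).

Both claims follow by comparing constants. The expression under this root is a constant multiple of
the action term, and the latent terms are nonnegative. In the first claim the multiple is a number
depending only on `K`, `L`, `σ` and the `s ℓ`. It is absorbed by `log (1 / δ)` when `δ` is below a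
threshold `exp (-Λ)`; above the threshold, `c n δ` exceeds the linear bound `c₁ n` on the regret as
soon as `c = c₁ exp Λ`. In the second claim the multiple is part of `C` and of the logarithmic
factor.
-/

namespace DiffusionTS

section

/-! ### Bayes' rule along a hierarchy -/

lemma lintegral_bayes {α : Type*} [MeasurableSpace α] (μ : Measure α) {f g : α → ℝ≥0∞}
    (hf : Measurable f) (hg : Measurable g) :
    ∫⁻ x, g x ∂(bayes μ f) = (∫⁻ x, f x ∂μ)⁻¹ * ∫⁻ x, f x * g x ∂μ := by
  rw [bayes, lintegral_smul_measure, lintegral_withDensity_eq_lintegral_mul _ hf hg]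
  rfl

/-- Drawing the latent variable from its posterior, and then the parameter from its conditional
posterior, amounts to drawing the parameter from its posterior under the marginal prior. -/
lemma bayes_bind_bayes {α β : Type*} [MeasurableSpace α] [MeasurableSpace β]
    (m : Measure α) [IsProbabilityMeasure m] {κ : α → Measure β} (hκ : Measurable κ)
    [∀ a, IsProbabilityMeasure (κ a)] {f : β → ℝ≥0∞} (hf : Measurable f) (hft : Tame f) :
    (bayes m fun a => ∫⁻ b, f b ∂(κ a)).bind (fun a => bayes (κ a) f) = bayes (m.bind κ) f := by
  have hZ : Measurable fun a => ∫⁻ b, f b ∂(κ a) := measurable_lintegral_uncurry hκ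
    (f := fun _ b => f b) (hf.comp measurable_snd)
  have hb : Measurable fun a => bayes (κ a) f := measurable_bayes hκ
    (f := fun _ b => f b) (hf.comp measurable_snd)
  obtain ⟨h0, C, hC, hle⟩ := hft.lintegral (m := κ) hf
  ext S hS
  have hSi : Measurable (S.indicator f) := hf.indicator hS
  have e1 : ∀ μ, bayes μ f S = (∫⁻ b, f b ∂μ)⁻¹ * ∫⁻ b, S.indicator f b ∂μ := fun μ => by
    rw [bayes, Measure.smul_apply, withDensity_apply _ hS, lintegral_indicator hS, smul_eq_mul]
  rw [Measure.bind_apply hS hb.aemeasurable, lintegral_bayes (g := fun a => bayes (κ a) f S) _ hZ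
    ((Measure.measurable_coe hS).comp hb), e1 (m.bind κ), Measure.lintegral_bind hκ.aemeasurable hf.aemeasurable,
    Measure.lintegral_bind hκ.aemeasurable hSi.aemeasurable]
  congr 1
  refine lintegral_congr fun a => ?_
  rw [e1, ← mul_assoc, ENNReal.mul_inv_cancel (h0 a) (ne_top_of_le_ne_top hC (hle a)), one_mul]

lemma lintegral_pi_prod {ι : Type*} [Fintype ι] {X : ι → Type*} [∀ i, MeasurableSpace (X i)]
    (μ : ∀ i, Measure (X i)) [∀ i, IsProbabilityMeasure (μ i)] {f : ∀ i, X i → ℝ≥0∞}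
    (hf : ∀ i, Measurable (f i)) :
    ∫⁻ x, ∏ i, f i (x i) ∂(Measure.pi μ) = ∏ i, ∫⁻ y, f i y ∂(μ i) := by
  have hi : iIndepFun (fun i (x : ∀ i, X i) => f i (x i)) (Measure.pi μ) :=
    iIndepFun_pi (X := fun i => f i) fun i => (hf i).aemeasurable
  rw [lintegral_prod_eq_prod_lintegral_of_indepFun Finset.univ _ hi
    fun i => (hf i).comp (measurable_pi_apply i)]
  refine Finset.prod_congr rfl fun i _ => ?_
  exact (measurePreserving_eval μ i).lintegral_comp (hf i)

lemma pi_withDensity {ι : Type*} [Fintype ι] {X : ι → Type*} [∀ i, MeasurableSpace (X i)]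
    (μ : ∀ i, Measure (X i)) [∀ i, IsProbabilityMeasure (μ i)] {f : ∀ i, X i → ℝ≥0∞}
    (hf : ∀ i, Measurable (f i)) [∀ i, SigmaFinite ((μ i).withDensity (f i))] :
    Measure.pi (fun i => (μ i).withDensity (f i))
      = (Measure.pi μ).withDensity fun x => ∏ i, f i (x i) := by
  classical
  refine Measure.pi_eq fun S hS => ?_
  rw [withDensity_apply _ (MeasurableSet.univ_pi hS), ← lintegral_indicator (.univ_pi hS)]
  have : (Set.univ.pi S).indicator (fun x => ∏ i, f i (x i))
      = fun x => ∏ i, (S i).indicator (f i) (x i) := by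
    ext x
    by_cases hx : x ∈ Set.univ.pi S
    · rw [Set.indicator_of_mem hx]
      exact Finset.prod_congr rfl fun i _ =>
        (Set.indicator_of_mem (hx i (Set.mem_univ i)) _).symm
    · rw [Set.indicator_of_notMem hx]
      simp only [Set.mem_pi, Set.mem_univ, true_imp_iff, not_forall] at hx
      obtain ⟨i, hi⟩ := hx
      exact (Finset.prod_eq_zero (Finset.mem_univ i) (Set.indicator_of_notMem hi _)).symm
  rw [this, lintegral_pi_prod μ fun i => (hf i).indicator (hS i)]
  exact Finset.prod_congr rfl fun i _ => by
    rw [lintegral_indicator (hS i), withDensity_apply _ (hS i)]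

/-- Independent coordinates stay independent under a likelihood that is a product. -/
lemma pi_bayes {ι : Type*} [Fintype ι] {X : ι → Type*} [∀ i, MeasurableSpace (X i)]
    (μ : ∀ i, Measure (X i)) [∀ i, IsProbabilityMeasure (μ i)] {f : ∀ i, X i → ℝ≥0∞}
    (hf : ∀ i, Measurable (f i)) (hft : ∀ i, Tame (f i)) :
    Measure.pi (fun i => bayes (μ i) (f i)) = bayes (Measure.pi μ) fun x => ∏ i, f i (x i) := by
  have hp : ∀ i, IsProbabilityMeasure (bayes (μ i) (f i)) := fun i => (hft i).isProb_bayes _ (hf i)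
  have h1 := fun i => (hft i).lintegral (m := fun _ : Unit => μ i) (hf i)
  have h0 : ∀ i, ∫⁻ y, f i y ∂(μ i) ≠ 0 := fun i => (h1 i).1 ()
  have ht : ∀ i, ∫⁻ y, f i y ∂(μ i) ≠ ∞ := fun i => by
    obtain ⟨C, hC, hle⟩ := (h1 i).2
    exact ne_top_of_le_ne_top hC (hle ())
  have hfin : ∀ i, IsFiniteMeasure ((μ i).withDensity (f i)) := fun i =>
    isFiniteMeasure_withDensity (ht i)
  refine Measure.pi_eq fun S hS => ?_
  rw [bayes, Measure.smul_apply, ← pi_withDensity μ hf, Measure.pi_pi, lintegral_pi_prod μ hf,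
    smul_eq_mul, ENNReal.prod_inv_distrib fun i _ j _ _ => Or.inl (h0 i), ← Finset.prod_mul_distrib]
  rfl

variable {K d t : ℕ} (L : ℕ) (W : ℕ → Matrix (Fin d) (Fin d) ℝ) (s : ℕ → ℝ) (σ : ℝ)

/-- The likelihood of the rewards of the history `h` under the parameters `θ`. -/
noncomputable def lik (h : History K d t) (θ : Fin K → Vec d) : ℝ≥0∞ :=
  ∏ a, actionLik σ h a (θ a)

lemma measurable_lik :
    Measurable fun p : History K d t × (Fin K → Vec d) => lik σ p.1 p.2 :=
  Finset.measurable_prod _ fun a _ => (measurable_actionLik σ a).comp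
    (f := fun p : History K d t × (Fin K → Vec d) => (p.1, p.2 a)) (by fun_prop)

lemma measurable_lik' (h : History K d t) : Measurable (lik σ h) :=
  Measurable.of_uncurry_left (f := fun (h : History K d t) θ => lik σ h θ) (measurable_lik σ)

lemma tame_lik (hσ : 0 < σ) (h : History K d t) : Tame (lik σ h) :=
  Tame.prod Finset.univ (f := fun a (θ : Fin K → Vec d) => actionLik σ h a (θ a)) fun a =>
    ⟨fun θ => (tame_actionLik σ hσ h a).1 (θ a), by
      obtain ⟨C, hC, hle⟩ := (tame_actionLik σ hσ h a).2
      exact ⟨C, hC, fun θ => hle (θ a)⟩⟩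

lemma latentLik_eq (h : History K d t) (j : ℕ) (ψ : Vec d) :
    latentLik W s σ h j ψ = ∫⁻ θ, lik σ h θ ∂(thetaGivenLatent W s j ψ) := by
  induction j generalizing ψ with
  | zero =>
    simp only [latentLik, thetaGivenLatent, lik]
    exact (lintegral_pi_prod _ fun a => measurable_actionLik' σ h a).symm
  | succ j ih =>
    simp only [latentLik, thetaGivenLatent]
    rw [Measure.lintegral_bind (thetaGivenLatent_good W s j).1.aemeasurable
      (measurable_lik' σ h).aemeasurable]
    exact lintegral_congr fun ψ' => ih ψ'

lemma dtsGivenLatent_eq (hσ : 0 < σ) (h : History K d t) (j : ℕ) (ψ : Vec d) :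
    dtsGivenLatent W s σ h j ψ = bayes (thetaGivenLatent W s j ψ) (lik σ h) := by
  induction j generalizing ψ with
  | zero =>
    simp only [dtsGivenLatent, thetaGivenLatent]
    exact pi_bayes _ (fun a => measurable_actionLik' σ h a) fun a => tame_actionLik σ hσ h a
  | succ j ih =>
    have := (thetaGivenLatent_good (K := K) W s j).2
    simp only [dtsGivenLatent, thetaGivenLatent, funext ih, funext (latentLik_eq W s σ h j)]
    exact bayes_bind_bayes _ (thetaGivenLatent_good W s j).1 (measurable_lik' σ h) (tame_lik σ hσ h)

/-- Diffusion Thompson sampling draws exactly from the posterior of the action parameters. -/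
lemma dtsSample_eq (hσ : 0 < σ) (h : History K d t) :
    dtsSample L W s σ h = bayes (prior L W s) (lik σ h) := by
  have := (thetaGivenLatent_good (K := K) W s (L - 1)).2
  simp only [dtsSample, prior, funext (dtsGivenLatent_eq W s σ hσ h (L - 1)),
    funext (latentLik_eq W s σ h (L - 1))]
  exact bayes_bind_bayes _ (thetaGivenLatent_good W s _).1 (measurable_lik' σ h) (tame_lik σ hσ h)

end

section

variable {K d t : ℕ} (L : ℕ) (W : ℕ → Matrix (Fin d) (Fin d) ℝ) (s : ℕ → ℝ) (σ : ℝ)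

/-! ### The posterior identity for the interaction -/

/-- The likelihood of a single round. -/
noncomputable def roundLik (r : Round K d) (θ : Fin K → Vec d) : ℝ≥0∞ :=
  gaussianPDF (inner ℝ r.1 (θ r.2.1)) (σ ^ 2).toNNReal r.2.2

lemma lik_eq_prod (h : History K d t) (θ : Fin K → Vec d) :
    lik σ h θ = ∏ i, roundLik σ (h i) θ := by
  rw [← Finset.prod_fiberwise (s := Finset.univ) (g := fun i => (h i).2.1)]
  refine Finset.prod_congr rfl fun a _ => Finset.prod_congr rfl fun i hi => ?_
  rw [roundLik, (Finset.mem_filter.mp hi).2]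

lemma lik_snoc (h : History K d t) (r : Round K d) (θ : Fin K → Vec d) :
    lik σ (Fin.snoc (α := fun _ => Round K d) h r : History K d (t + 1)) θ
      = lik σ h θ * roundLik σ r θ := by
  simp [lik_eq_prod, Fin.prod_univ_castSucc]

lemma measurable_roundLik :
    Measurable fun q : Round K d × (Fin K → Vec d) => roundLik σ q.1 q.2 := by
  have h1 : Measurable fun q : Round K d × (Fin K → Vec d) => q.2 q.1.2.1 :=
    measurable_apply_sel (f := fun q : Round K d × (Fin K → Vec d) => q.2) measurable_snd
      (by fun_prop)
  have h := measurable_uncurry_gaussianPDFReal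
  exact (h.comp (f := fun q : Round K d × (Fin K → Vec d) =>
    ((inner ℝ q.1.1 (q.2 q.1.2.1) : ℝ), (σ ^ 2).toNNReal, q.1.2.2))
      (by fun_prop)).ennreal_ofReal

/-- Bayes' rule may be applied sequentially, one round at a time. -/
lemma lintegral_roundLik_mul (hσ : 0 < σ) (h : History K d t) (r : Round K d)
    {F : (Fin K → Vec d) → ℝ≥0∞} (hF : Measurable F) :
    ∫⁻ θ, roundLik σ r θ * F θ ∂(dtsSample L W s σ h)
      = (∫⁻ θ, roundLik σ r θ ∂(dtsSample L W s σ h)) *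
        ∫⁻ θ, F θ ∂(dtsSample L W s σ
          (Fin.snoc (α := fun _ => Round K d) h r : History K d (t + 1))) := by
  have hr : Measurable (roundLik (K := K) (d := d) σ r) :=
    (measurable_roundLik σ).comp (f := fun θ => (r, θ)) (by fun_prop)
  have hl := measurable_lik' (d := d) σ h
  obtain ⟨h0, C, hC, hle⟩ := (tame_lik σ hσ
    (Fin.snoc (α := fun _ => Round K d) h r : History K d (t + 1))).lintegral
    (m := fun _ : Unit => prior L W s) (measurable_lik' σ _)
  have h1 := h0 ()
  have h2 := ne_top_of_le_ne_top hC (hle ())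
  rw [dtsSample_eq L W s σ hσ, dtsSample_eq L W s σ hσ, lintegral_bayes _ hl hr,
    lintegral_bayes (g := fun θ => roundLik σ r θ * F θ) _ hl (hr.mul hF), lintegral_bayes _ (measurable_lik' σ _) hF]
  simp only [lik_snoc] at h1 h2 ⊢
  rw [mul_assoc, ← mul_assoc (∫⁻ x, lik σ h x * roundLik σ r x ∂(prior L W s)), ENNReal.mul_inv_cancel h1 h2,
    one_mul]
  simp only [mul_assoc]

/-- The law of the context, the sampled parameters and (before weighting by the density of the
reward) the reward of a round played after the history `h`. -/
noncomputable def roundRef (ctx : Kernel (History K d t) (Vec d)) (h : History K d t) :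
    Measure (Vec d × (Fin K → Vec d) × ℝ) :=
  (ctx h).prod ((dtsSample L W s σ h).prod volume)

/-- The round played when the context is `q.1`, the sampled parameters are `q.2.1` and the reward
is `q.2.2`. -/
def playRound (sel : Vec d → (Fin K → Vec d) → Fin K) (q : Vec d × (Fin K → Vec d) × ℝ) :
    Round K d :=
  (q.1, sel q.1 q.2.1, q.2.2)

lemma measurable_playRound {sel : Vec d → (Fin K → Vec d) → Fin K}
    (hsel : Measurable (Function.uncurry sel)) : Measurable (playRound sel) :=
  measurable_fst.prodMk ((hsel.comp (f := fun q : Vec d × (Fin K → Vec d) × ℝ => (q.1, q.2.1))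
    (by fun_prop)).prodMk measurable_snd.snd)

lemma lintegral_nextRound (hσ : 0 < σ) (ctx : Kernel (History K d t) (Vec d)) [IsMarkovKernel ctx]
    {sel : Vec d → (Fin K → Vec d) → Fin K} (hsel : Measurable (Function.uncurry sel))
    (p : (Fin K → Vec d) × History K d t)
    {F : (Fin K → Vec d) × History K d (t + 1) → ℝ≥0∞} (hF : Measurable F) :
    ∫⁻ z, F z ∂(nextRound L W s σ ctx sel p)
      = ∫⁻ q, roundLik σ (playRound sel q) p.1 *
          F (p.1, Fin.snoc (α := fun _ => Round K d) p.2 (playRound sel q))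
        ∂(roundRef L W s σ ctx p.2) := by
  have hdp := (dtsSample_good (K := K) (t := t) L W s σ hσ).2
  have hv : (σ ^ 2).toNNReal ≠ 0 := by simpa using hσ.ne'
  have hrp : ∀ x θa : Vec d, IsProbabilityMeasure (rewardDist σ x θa) := fun x θa => by
    unfold rewardDist; infer_instance
  have hmk : Measurable fun r : Round K d =>
      (p.1, (Fin.snoc (α := fun _ => Round K d) p.2 r : History K d (t + 1))) :=
    measurable_const.prodMk (measurable_snoc.comp (measurable_const.prodMk measurable_id))
  have hrw : Measurable fun w : Vec d × (Fin K → Vec d) =>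
      rewardDist σ w.1 (p.1 (sel w.1 w.2)) := by
    have := measurable_apply_sel (f := fun _ : Vec d × (Fin K → Vec d) => p.1) measurable_const hsel
    exact (measurable_gaussianReal_mean _).comp (measurable_fst.inner this)
  have hG : Measurable (Function.uncurry fun (x : Vec d) (θt : Fin K → Vec d) =>
      (rewardDist σ x (p.1 (sel x θt))).map fun y => (p.1,
        (Fin.snoc (α := fun _ => Round K d) p.2 (x, sel x θt, y) : History K d (t + 1)))) :=
    measurable_map_uncurry hrw (g := fun w y => (p.1,
      (Fin.snoc (α := fun _ => Round K d) p.2 (w.1, sel w.1 w.2, y) : History K d (t + 1))))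
      (hmk.comp ((measurable_fst.fst).prodMk
        ((hsel.comp measurable_fst).prodMk measurable_snd)))
  have hB : Measurable fun x => (dtsSample L W s σ p.2).bind fun θt =>
      (rewardDist σ x (p.1 (sel x θt))).map fun y => (p.1,
        (Fin.snoc (α := fun _ => Round K d) p.2 (x, sel x θt, y) : History K d (t + 1))) :=
    measurable_bind_uncurry (m := fun _ : Vec d => dtsSample L W s σ p.2) measurable_const hG
  have hH : Measurable fun q : Vec d × (Fin K → Vec d) × ℝ =>
      roundLik σ (playRound sel q) p.1 *
        F (p.1, Fin.snoc (α := fun _ => Round K d) p.2 (playRound sel q)) :=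
    ((measurable_roundLik σ).comp ((measurable_playRound hsel).prodMk measurable_const)).mul
      (hF.comp (hmk.comp (measurable_playRound hsel)))
  rw [nextRound, Measure.lintegral_bind hB.aemeasurable hF.aemeasurable, roundRef,
    lintegral_prod _ hH.aemeasurable]
  refine lintegral_congr fun x => ?_
  rw [Measure.lintegral_bind (hG.of_uncurry_left (x := x)).aemeasurable hF.aemeasurable,
    lintegral_prod (fun z : (Fin K → Vec d) × ℝ => roundLik σ (playRound sel (x, z)) p.1 *
        F (p.1, Fin.snoc (α := fun _ => Round K d) p.2 (playRound sel (x, z)))) (hH.comp (f := fun z : (Fin K → Vec d) × ℝ => (x, z))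
      (by fun_prop)).aemeasurable]
  refine lintegral_congr fun θt => ?_
  have hy : Measurable fun y : ℝ => (p.1,
      (Fin.snoc (α := fun _ => Round K d) p.2 (x, sel x θt, y) : History K d (t + 1))) :=
    hmk.comp (measurable_const.prodMk (measurable_const.prodMk measurable_id))
  rw [lintegral_map hF hy, rewardDist, gaussianReal_of_var_ne_zero _ hv]
  exact lintegral_withDensity_eq_lintegral_mul _ (measurable_gaussianPDF _ _) (hF.comp hy)

lemma measurable_lintegral_nextRound (hσ : 0 < σ) (ctx : Kernel (History K d t) (Vec d))
    [IsMarkovKernel ctx] {sel : Vec d → (Fin K → Vec d) → Fin K}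
    (hsel : Measurable (Function.uncurry sel))
    {F : (Fin K → Vec d) × History K d (t + 1) → ℝ≥0∞} (hF : Measurable F) :
    Measurable fun p => ∫⁻ z, F z ∂(nextRound L W s σ ctx sel p) :=
  (Measure.measurable_lintegral hF).comp (nextRound_good L W s σ hσ ctx hsel).1

section

variable (ctx : (t : ℕ) → Kernel (History K d t) (Vec d)) {sel : Vec d → (Fin K → Vec d) → Fin K}

lemma lintegral_law_succ (hσ : 0 < σ) (hctx : ∀ t, IsMarkovKernel (ctx t))
    (hsel : Measurable (Function.uncurry sel)) (t : ℕ)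
    {F : (Fin K → Vec d) × History K d (t + 1) → ℝ≥0∞} (hF : Measurable F) :
    ∫⁻ z, F z ∂(law L W s σ ctx sel (t + 1)) = ∫⁻ p, ∫⁻ z, F z ∂(nextRound L W s σ (ctx t) sel p)
      ∂(law L W s σ ctx sel t) := by
  rw [law, Measure.lintegral_bind (nextRound_good L W s σ hσ (ctx t) hsel).1.aemeasurable
    hF.aemeasurable]

/-- Given the history, the parameters are distributed as the Thompson sample. -/
theorem lintegral_law_eq_lintegral_posterior (hσ : 0 < σ) (hctx : ∀ t, IsMarkovKernel (ctx t))
    (hsel : Measurable (Function.uncurry sel)) (t : ℕ)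
    {F : (Fin K → Vec d) × History K d t → ℝ≥0∞} (hF : Measurable F) :
    ∫⁻ p, F p ∂(law L W s σ ctx sel t)
      = ∫⁻ p, ∫⁻ θ, F (θ, p.2) ∂(dtsSample L W s σ p.2) ∂(law L W s σ ctx sel t) := by
  have post_meas : ∀ {t : ℕ} {F : (Fin K → Vec d) × History K d t → ℝ≥0∞}, Measurable F →
      Measurable fun h => ∫⁻ θ, F (θ, h) ∂(dtsSample L W s σ h) := fun {t F} hF => by
    have hd := dtsSample_good (K := K) (t := t) L W s σ hσ
    have := hd.2
    exact measurable_lintegral_uncurry hd.1 (f := fun h θ => F (θ, h)) (hF.comp measurable_swap)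
  induction t with
  | zero =>
    have hm : Measurable fun θ : Fin K → Vec d => (θ, (Fin.elim0 : History K d 0)) :=
      measurable_id.prodMk measurable_const
    have h0 : dtsSample L W s σ (Fin.elim0 : History K d 0) = prior L W s := by
      rw [dtsSample_eq L W s σ hσ]
      have : lik (K := K) (d := d) σ (Fin.elim0 : History K d 0) = 1 := by
        ext θ; simp [lik_eq_prod]
      rw [this, bayes]; simp
    rw [law, lintegral_map hF hm, lintegral_map (f := fun p : (Fin K → Vec d) × History K d 0 =>
      ∫⁻ θ, F (θ, p.2) ∂(dtsSample L W s σ p.2)) ((post_meas hF).comp measurable_snd) hm]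
    simp [h0]
  | succ t ih =>
    have hd := dtsSample_good (K := K) (t := t) L W s σ hσ
    have := hd.2
    have hsn : Measurable fun w : (Fin K → Vec d) × History K d t × Vec d × (Fin K → Vec d) × ℝ =>
        (w.1, (Fin.snoc (α := fun _ => Round K d) w.2.1 (playRound sel w.2.2) :
          History K d (t + 1))) :=
      measurable_fst.prodMk (measurable_snoc.comp
        (measurable_snd.fst.prodMk ((measurable_playRound hsel).comp measurable_snd.snd)))
    have key : ∀ {F : (Fin K → Vec d) × History K d (t + 1) → ℝ≥0∞}, Measurable F →
        ∫⁻ z, F z ∂(law L W s σ ctx sel (t + 1)) =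
          ∫⁻ p, ∫⁻ q, (∫⁻ θ, roundLik σ (playRound sel q) θ ∂(dtsSample L W s σ p.2)) *
            ∫⁻ θ, F (θ, Fin.snoc (α := fun _ => Round K d) p.2 (playRound sel q))
              ∂(dtsSample L W s σ
                (Fin.snoc (α := fun _ => Round K d) p.2 (playRound sel q) : History K d (t + 1)))
            ∂(roundRef L W s σ (ctx t) p.2) ∂(law L W s σ ctx sel t) := by
      intro F hF
      have hH : Measurable fun w : (Fin K → Vec d) × History K d t × Vec d × (Fin K → Vec d) × ℝ =>
          roundLik σ (playRound sel w.2.2) w.1 *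
            F (w.1, Fin.snoc (α := fun _ => Round K d) w.2.1 (playRound sel w.2.2)) :=
        ((measurable_roundLik σ).comp
          (((measurable_playRound hsel).comp measurable_snd.snd).prodMk measurable_fst)).mul
          (hF.comp hsn)
      rw [lintegral_law_succ L W s σ ctx hσ hctx hsel t hF]
      rw [ih (measurable_lintegral_nextRound L W s σ hσ (ctx t) hsel hF)]
      refine lintegral_congr fun p => ?_
      have : SFinite (roundRef L W s σ (ctx t) p.2) := by unfold roundRef; infer_instance
      simp_rw [fun θ => lintegral_nextRound L W s σ hσ (ctx t) hsel (θ, p.2) hF]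
      rw [lintegral_lintegral_swap]
      · refine lintegral_congr fun q => ?_
        exact lintegral_roundLik_mul L W s σ hσ p.2 (playRound sel q)
          (F := fun θ => F (θ, Fin.snoc (α := fun _ => Round K d) p.2 (playRound sel q)))
          (hF.comp (measurable_id.prodMk measurable_const))
      · exact (hH.comp (f := fun w : (Fin K → Vec d) × Vec d × (Fin K → Vec d) × ℝ =>
          (w.1, p.2, w.2)) (by fun_prop)).aemeasurable
    have hp := (dtsSample_good (K := K) (t := t + 1) L W s σ hσ).2
    rw [key hF, key (F := fun p => ∫⁻ θ, F (θ, p.2) ∂(dtsSample L W s σ p.2))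
      ((post_meas hF).comp measurable_snd)]
    simp

/-- Seen from the history, a round consists of a context, of a Thompson sample `θt` that selects the
action, and of parameters `θ` that are an independent copy of the Thompson sample. -/
theorem lintegral_law_succ_round (hσ : 0 < σ) (hctx : ∀ t, IsMarkovKernel (ctx t))
    (hsel : Measurable (Function.uncurry sel)) (t : ℕ)
    {F : (Fin K → Vec d) × History K d t × Vec d × Fin K → ℝ≥0∞} (hF : Measurable F) :
    ∫⁻ z, F (z.1, Fin.init (α := fun _ => Round K d) z.2, (z.2 (Fin.last t)).1,
        (z.2 (Fin.last t)).2.1) ∂(law L W s σ ctx sel (t + 1))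
      = ∫⁻ p, ∫⁻ x, ∫⁻ θt, ∫⁻ θ, F (θ, p.2, x, sel x θt) ∂(dtsSample L W s σ p.2)
          ∂(dtsSample L W s σ p.2) ∂(ctx t p.2) ∂(law L W s σ ctx sel t) := by
  have hd := dtsSample_good (K := K) (t := t) L W s σ hσ
  have := hd.2
  have hF' : Measurable fun z : (Fin K → Vec d) × History K d (t + 1) =>
      F (z.1, Fin.init (α := fun _ => Round K d) z.2, (z.2 (Fin.last t)).1,
        (z.2 (Fin.last t)).2.1) := by
    refine hF.comp (measurable_fst.prodMk (Measurable.prodMk ?_ (by fun_prop)))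
    exact measurable_pi_iff.mpr fun i => (measurable_pi_apply (Fin.castSucc i)).comp measurable_snd
  rw [lintegral_law_succ L W s σ ctx hσ hctx hsel t hF',
    lintegral_law_eq_lintegral_posterior L W s σ ctx hσ hctx hsel t
      (measurable_lintegral_nextRound L W s σ hσ (ctx t) hsel hF')]
  refine lintegral_congr fun p => ?_
  have hint : ∀ θ, ∫⁻ z, F (z.1, Fin.init (α := fun _ => Round K d) z.2, (z.2 (Fin.last t)).1,
        (z.2 (Fin.last t)).2.1) ∂(nextRound L W s σ (ctx t) sel (θ, p.2))
      = ∫⁻ w, F (θ, p.2, w.1, sel w.1 w.2) ∂((ctx t p.2).prod (dtsSample L W s σ p.2)) := by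
    intro θ
    have hv : (σ ^ 2).toNNReal ≠ 0 := by simpa using hσ.ne'
    have hH : Measurable fun q : Vec d × (Fin K → Vec d) × ℝ =>
        roundLik σ (playRound sel q) θ * F (θ, p.2, q.1, sel q.1 q.2.1) :=
      ((measurable_roundLik σ).comp ((measurable_playRound hsel).prodMk measurable_const)).mul
        (hF.comp (measurable_const.prodMk (measurable_const.prodMk (measurable_fst.prodMk
          (hsel.comp (measurable_fst.prodMk measurable_snd.fst))))))
    have hR : Measurable fun w : Vec d × (Fin K → Vec d) => F (θ, p.2, w.1, sel w.1 w.2) :=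
      hF.comp (measurable_const.prodMk (measurable_const.prodMk (measurable_fst.prodMk hsel)))
    rw [lintegral_nextRound L W s σ hσ (ctx t) hsel (θ, p.2) hF', roundRef]
    simp only [Fin.init_snoc, Fin.snoc_last]
    rw [lintegral_prod _ hR.aemeasurable]
    refine (lintegral_prod _ hH.aemeasurable).trans (lintegral_congr fun x => ?_)
    refine (lintegral_prod _ (hH.comp (f := fun z : (Fin K → Vec d) × ℝ => (x, z))
      (by fun_prop)).aemeasurable).trans (lintegral_congr fun θt => ?_)
    change ∫⁻ y, roundLik σ (x, sel x θt, y) θ * F (θ, p.2, x, sel x θt) = _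
    simp only [roundLik]
    rw [lintegral_mul_const _ (measurable_gaussianPDF _ _), lintegral_gaussianPDF_eq_one _ hv,
      one_mul]
  have hG : Measurable fun w : (Fin K → Vec d) × Vec d × (Fin K → Vec d) =>
      F (w.1, p.2, w.2.1, sel w.2.1 w.2.2) :=
    hF.comp (measurable_fst.prodMk (measurable_const.prodMk (measurable_snd.fst.prodMk
      (hsel.comp measurable_snd))))
  simp_rw [hint]
  rw [lintegral_lintegral_swap hG.aemeasurable, lintegral_prod]
  have hd' : Measurable fun _ : Vec d × (Fin K → Vec d) => dtsSample L W s σ p.2 := measurable_const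
  exact (measurable_lintegral_uncurry hd' (f := fun w θ => F (θ, p.2, w.1, sel w.1 w.2))
    (hG.comp measurable_swap)).aemeasurable

end

end

section

variable {K d t : ℕ} (L : ℕ) (W : ℕ → Matrix (Fin d) (Fin d) ℝ) (s : ℕ → ℝ) (σ : ℝ)

/-! ### The prior as a linear image of Gaussian noise -/

/-- The law of independent standard Gaussian coordinates. -/
noncomputable def noise (ι : Type*) [Fintype ι] : Measure (ι → ℝ) :=
  Measure.pi fun _ => gaussianReal 0 1

instance (ι : Type*) [Fintype ι] : IsProbabilityMeasure (noise ι) := by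
  unfold noise; infer_instance

open scoped MatrixOrder in
lemma multivariateGaussian_eq_map_noise (c : Vec d) {r : ℝ} (hr : 0 ≤ r) :
    multivariateGaussian c ((r ^ 2) • (1 : Matrix (Fin d) (Fin d) ℝ))
      = (noise (Fin d)).map fun z => c + r • WithLp.toLp 2 z := by
  have h0 : (0 : Matrix (Fin d) (Fin d) ℝ) ≤ r • 1 := smul_nonneg hr zero_le_one
  have h1 : CFC.sqrt ((r ^ 2) • (1 : Matrix (Fin d) (Fin d) ℝ)) = r • 1 := by
    have : (r ^ 2) • (1 : Matrix (Fin d) (Fin d) ℝ) = (r • 1) * (r • 1) := by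
      rw [smul_mul_smul_comm, mul_one, sq]
    rw [this, CFC.sqrt_mul_self _ h0]
  rw [multivariateGaussian, h1, ← map_pi_eq_stdGaussian, Measure.map_map (by fun_prop) (by fun_prop)]
  congr 1
  ext z
  simp

/-- The linear part of a composition of two layers, the noise of the first one having size `r`. -/
noncomputable def layerMap {ι F : Type*} [AddCommGroup F] [Module ℝ F] (r : ℝ) (T : Vec d →ₗ[ℝ] F)
    (A : (ι → ℝ) →ₗ[ℝ] F) : (Fin d ⊕ ι → ℝ) →ₗ[ℝ] F :=
  r • (T ∘ₗ (WithLp.linearEquiv 2 ℝ (Fin d → ℝ)).symm.toLinearMap ∘ₗ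
    LinearMap.funLeft ℝ ℝ (Sum.inl : Fin d → Fin d ⊕ ι)) + A ∘ₗ LinearMap.funLeft ℝ ℝ Sum.inr

lemma layerMap_apply {ι F : Type*} [AddCommGroup F] [Module ℝ F] (r : ℝ) (T : Vec d →ₗ[ℝ] F)
    (A : (ι → ℝ) →ₗ[ℝ] F) (z : Fin d ⊕ ι → ℝ) :
    layerMap r T A z = r • T (WithLp.toLp 2 fun i => z (Sum.inl i)) + A fun i => z (Sum.inr i) :=
  rfl

lemma bind_map_noise {ι : Type*} [Fintype ι] (c : Vec d) (r : ℝ)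
    (T : Vec d →ₗ[ℝ] (Fin K → Vec d)) (A : (ι → ℝ) →ₗ[ℝ] (Fin K → Vec d)) :
    ((noise (Fin d)).map fun z => c + r • WithLp.toLp 2 z).bind
        (fun ψ => (noise ι).map fun z => T ψ + A z)
      = (noise (Fin d ⊕ ι)).map fun z => T c + layerMap r T A z := by
  have hT : Measurable T := T.continuous_of_finiteDimensional.measurable
  have hA : Measurable A := A.continuous_of_finiteDimensional.measurable
  have hB : Measurable (layerMap r T A) :=
    (layerMap r T A).continuous_of_finiteDimensional.measurable
  have hκ : Measurable fun ψ => (noise ι).map fun z => T ψ + A z :=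
    measurable_map_uncurry (m := fun _ : Vec d => noise ι) measurable_const
      (g := fun ψ z => T ψ + A z) (by fun_prop)
  have hz : Measurable fun z : Fin d → ℝ => c + r • WithLp.toLp 2 z := by fun_prop
  refine Measure.ext_of_lintegral _ fun f hf => ?_
  rw [Measure.lintegral_bind hκ.aemeasurable hf.aemeasurable,
    lintegral_map (f := fun ψ => ∫⁻ x, f x ∂((noise ι).map fun z => T ψ + A z))
      (Measure.measurable_lintegral hf |>.comp hκ) hz, lintegral_map hf (by fun_prop)]
  have hp := measurePreserving_sumPiEquivProdPi_symm (X := fun _ : Fin d ⊕ ι => ℝ)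
    (fun _ => gaussianReal 0 1)
  rw [noise, noise, noise, ← hp.map_eq, lintegral_map (by fun_prop) hp.measurable, lintegral_prod]
  · refine lintegral_congr fun z₁ => ?_
    rw [lintegral_map hf (by fun_prop)]
    refine lintegral_congr fun z₂ => ?_
    simp only [layerMap_apply, map_add, map_smul, add_assoc]
    rfl
  · exact (hf.comp ((measurable_const.add hB).comp hp.measurable)).aemeasurable

/-- A matrix `W` such that `Wᵀ W` has the largest eigenvalue `1` is a contraction. -/
lemma TopEigenvalueOne.norm_le {W : Matrix (Fin d) (Fin d) ℝ} (hW : TopEigenvalueOne W)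
    (ψ : Vec d) : ‖Matrix.toEuclideanCLM (𝕜 := ℝ) W ψ‖ ≤ ‖ψ‖ := by
  have hA : (W.transpose * W).IsHermitian := by
    simpa using Matrix.isHermitian_conjTranspose_mul_self W
  have hev : ∀ i, hA.eigenvalues i ≤ 1 := fun i => by
    refine hW.2 (Module.End.hasEigenvalue_of_hasEigenvector
      (x := (hA.eigenvectorBasis i : Fin d → ℝ)) ⟨?_, ?_⟩)
    · rw [Module.End.mem_eigenspace_iff, Matrix.toLin'_apply, hA.mulVec_eigenvectorBasis]
    · intro h0
      exact hA.eigenvectorBasis.orthonormal.ne_zero i (by ext j; exact congrFun h0 j)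
  set M := Matrix.toEuclideanCLM (𝕜 := ℝ) W with hM
  have hT : ∀ x y : Vec d, inner ℝ (M x) (M y)
      = inner ℝ x (Matrix.toEuclideanCLM (𝕜 := ℝ) (W.transpose * W) y) := fun x y => by
    have : Matrix.toEuclideanCLM (𝕜 := ℝ) W.transpose = M.adjoint := by
      rw [← ContinuousLinearMap.star_eq_adjoint, hM, ← map_star]; rfl
    rw [map_mul, this, ← hM, mul_apply_eq_comp, ContinuousLinearMap.adjoint_inner_right]
  have hb : ∀ i, Matrix.toEuclideanCLM (𝕜 := ℝ) (W.transpose * W) (hA.eigenvectorBasis i)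
      = hA.eigenvalues i • hA.eigenvectorBasis i := fun i => by
    ext j
    exact congrFun (hA.mulVec_eigenvectorBasis i) j
  refine (sq_le_sq₀ (norm_nonneg _) (norm_nonneg _)).mp ?_
  rw [← real_inner_self_eq_norm_sq, ← real_inner_self_eq_norm_sq, hT,
    ← hA.eigenvectorBasis.sum_inner_mul_inner, ← hA.eigenvectorBasis.sum_inner_mul_inner]
  refine Finset.sum_le_sum fun i _ => ?_
  have h1 : inner ℝ (hA.eigenvectorBasis i) (Matrix.toEuclideanCLM (𝕜 := ℝ) (W.transpose * W) ψ)
      = hA.eigenvalues i * inner ℝ (hA.eigenvectorBasis i) ψ := by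
    rw [← hT, real_inner_comm, hT, hb, inner_smul_right, real_inner_comm]
  rw [h1, real_inner_comm]
  nlinarith [hev i, sq_nonneg (inner ℝ ψ (hA.eigenvectorBasis i)),
    real_inner_comm ψ (hA.eigenvectorBasis i)]

lemma norm_layerMap_sq_le {ι : Type*} [Fintype ι] {r C : ℝ} (hr : 0 ≤ r) (hC : 0 ≤ C)
    {T : Vec d →ₗ[ℝ] (Fin K → Vec d)} {A : (ι → ℝ) →ₗ[ℝ] (Fin K → Vec d)}
    (hT : ∀ ψ a, ‖T ψ a‖ ≤ ‖ψ‖) (hA : ∀ z a, ‖A z a‖ ^ 2 ≤ C * ∑ i, z i ^ 2)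
    (z : Fin d ⊕ ι → ℝ) (a : Fin K) :
    ‖layerMap r T A z a‖ ^ 2 ≤ (C + r ^ 2) * ∑ i, z i ^ 2 := by
  set x : Vec d := WithLp.toLp 2 fun i => z (Sum.inl i) with hx
  set w : ι → ℝ := fun i => z (Sum.inr i) with hw
  have hz : ∑ i, z i ^ 2 = ‖x‖ ^ 2 + ∑ i, w i ^ 2 := by
    rw [Fintype.sum_sum_type, EuclideanSpace.real_norm_sq_eq]
  have hm : 0 ≤ ∑ i, w i ^ 2 := Finset.sum_nonneg fun i _ => sq_nonneg _
  have h1 : ‖layerMap r T A z a‖ ≤ r * ‖x‖ + ‖A w a‖ := by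
    rw [layerMap_apply]
    refine (norm_add_le _ _).trans (add_le_add ?_ le_rfl)
    rw [Pi.smul_apply, norm_smul, Real.norm_of_nonneg hr]
    exact mul_le_mul_of_nonneg_left (hT x a) hr
  have h2 : ‖A w a‖ ≤ √C * √(∑ i, w i ^ 2) := by
    rw [← Real.sqrt_mul hC]
    exact Real.le_sqrt_of_sq_le (hA w a)
  have h3 : ‖layerMap r T A z a‖ ^ 2 ≤ (r * ‖x‖ + √C * √(∑ i, w i ^ 2)) ^ 2 :=
    pow_le_pow_left₀ (norm_nonneg _) (h1.trans (by linarith)) 2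
  rw [hz]
  nlinarith [sq_nonneg (r * √(∑ i, w i ^ 2) - √C * ‖x‖), Real.sq_sqrt hC, Real.sq_sqrt hm]

lemma pi_noise (ι κ : Type*) [Fintype ι] [Fintype κ] :
    Measure.pi (fun _ : ι => noise κ) = (noise (ι × κ)).map fun z i j => z (i, j) := by
  simp_rw [noise, ← Measure.infinitePi_eq_pi]
  exact (Measure.infinitePi_map_curry (fun (_ : ι) (_ : κ) => gaussianReal 0 1)).symm

/-- Given `ψ_{j+1} = ψ`, the action parameters are an affine function of Gaussian noise; the
dependence on `ψ` is contracting and the noise of an arm has covariance at most `∑ s_ℓ²`. -/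
lemma thetaGivenLatent_eq_map_noise (j : ℕ) (hs : ∀ ℓ ∈ Finset.Icc 1 (j + 1), 0 < s ℓ)
    (hW : ∀ ℓ ∈ Finset.Icc 1 (j + 1), TopEigenvalueOne (W ℓ)) :
    ∃ (ι : Type) (_ : Fintype ι) (T : Vec d →ₗ[ℝ] (Fin K → Vec d))
      (A : (ι → ℝ) →ₗ[ℝ] (Fin K → Vec d)),
      (∀ ψ, thetaGivenLatent W s j ψ = (noise ι).map fun z => T ψ + A z) ∧
      (∀ ψ a, ‖T ψ a‖ ≤ ‖ψ‖) ∧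
      ∀ z a, ‖A z a‖ ^ 2 ≤ (∑ ℓ ∈ Finset.Icc 1 (j + 1), s ℓ ^ 2) * ∑ i, z i ^ 2 := by
  induction j with
  | zero =>
    let M := Matrix.toEuclideanCLM (𝕜 := ℝ) (W 1)
    let A : (Fin K × Fin d → ℝ) →ₗ[ℝ] (Fin K → Vec d) := LinearMap.pi fun a =>
      s 1 • (WithLp.linearEquiv 2 ℝ (Fin d → ℝ)).symm.toLinearMap ∘ₗ
        LinearMap.funLeft ℝ ℝ (fun i => (a, i))
    have h1 : 0 < s 1 := hs 1 (by simp)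
    refine ⟨Fin K × Fin d, inferInstance, LinearMap.pi fun _ => M.toLinearMap, A, fun ψ => ?_,
      fun ψ a => (hW 1 (by simp)).norm_le ψ, fun z a => ?_⟩
    · simp only [thetaGivenLatent, linkDist, multivariateGaussian_eq_map_noise _ h1.le]
      rw [← Measure.pi_map_pi (by fun_prop), pi_noise, Measure.map_map (by fun_prop) (by fun_prop)]
      rfl
    · have : A z a = s 1 • WithLp.toLp 2 fun i => z (a, i) := rfl
      rw [this, norm_smul, mul_pow, Real.norm_of_nonneg h1.le, EuclideanSpace.real_norm_sq_eq,
        Fintype.sum_prod_type]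
      simp only [zero_add, Finset.Icc_self, Finset.sum_singleton]
      exact mul_le_mul_of_nonneg_left (Finset.single_le_sum
        (f := fun a => ∑ i, z (a, i) ^ 2) (fun a _ => Finset.sum_nonneg fun i _ => sq_nonneg _)
        (Finset.mem_univ a)) (sq_nonneg _)
  | succ j ih =>
    have hsub : Finset.Icc 1 (j + 1) ⊆ Finset.Icc 1 (j + 1 + 1) :=
      Finset.Icc_subset_Icc_right (Nat.le_succ _)
    obtain ⟨ι, _, T, A, h1, h2, h3⟩ := ih (fun ℓ hℓ => hs ℓ (hsub hℓ)) fun ℓ hℓ => hW ℓ (hsub hℓ)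
    have hj : j + 2 ∈ Finset.Icc 1 (j + 1 + 1) := by simp
    let M := Matrix.toEuclideanCLM (𝕜 := ℝ) (W (j + 2))
    refine ⟨Fin d ⊕ ι, inferInstance, T ∘ₗ M.toLinearMap, layerMap (s (j + 2)) T A, fun ψ => ?_,
      fun ψ a => (h2 _ a).trans ((hW _ hj).norm_le ψ), fun z a => ?_⟩
    · simp only [thetaGivenLatent, linkDist, multivariateGaussian_eq_map_noise _ (hs _ hj).le,
        funext h1]
      exact bind_map_noise _ _ T A
    · rw [Finset.sum_Icc_succ_top (by omega)]
      exact norm_layerMap_sq_le (hs _ hj).le (Finset.sum_nonneg fun _ _ => sq_nonneg _) h2 h3 z a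

lemma prior_eq_map_noise (hL : 1 ≤ L) (hs : ∀ ℓ ∈ Finset.Icc 1 (L + 1), 0 < s ℓ)
    (hW : ∀ ℓ ∈ Finset.Icc 1 L, TopEigenvalueOne (W ℓ)) :
    ∃ (ι : Type) (_ : Fintype ι) (A : (ι → ℝ) →ₗ[ℝ] (Fin K → Vec d)),
      prior L W s = (noise ι).map A ∧
      ∀ z a, ‖A z a‖ ^ 2 ≤ (∑ ℓ ∈ Finset.Icc 1 (L + 1), s ℓ ^ 2) * ∑ i, z i ^ 2 := by
  obtain ⟨j, rfl⟩ := Nat.exists_eq_add_of_le' hL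
  have hsub : Finset.Icc 1 (j + 1) ⊆ Finset.Icc 1 (j + 1 + 1) :=
    Finset.Icc_subset_Icc_right (Nat.le_succ _)
  obtain ⟨ι, _, T, A, h1, h2, h3⟩ :=
    thetaGivenLatent_eq_map_noise (K := K) W s j (fun ℓ hℓ => hs ℓ (hsub hℓ)) hW
  have hj : j + 1 + 1 ∈ Finset.Icc 1 (j + 1 + 1) := by simp
  refine ⟨Fin d ⊕ ι, inferInstance, layerMap (s (j + 1 + 1)) T A, ?_, fun z a => ?_⟩
  · rw [prior, topDist, Nat.add_sub_cancel, multivariateGaussian_eq_map_noise _ (hs _ hj).le,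
      funext h1, bind_map_noise]
    simp
  · rw [Finset.sum_Icc_succ_top (by omega)]
    exact norm_layerMap_sq_le (hs _ hj).le (Finset.sum_nonneg fun _ _ => sq_nonneg _) h2 h3 z a

/-! ### Shifting Gaussian noise -/

lemma gaussianPDF_shift (e : ℝ) (y : ℝ) :
    gaussianPDF e 1 y = gaussianPDF 0 1 y * ENNReal.ofReal (Real.exp (y * e - e ^ 2 / 2)) := by
  rw [gaussianPDF, gaussianPDF, ← ENNReal.ofReal_mul (gaussianPDFReal_nonneg _ _ _),
    gaussianPDFReal, gaussianPDFReal, mul_assoc (_⁻¹), ← Real.exp_add]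
  congr 3
  push_cast
  ring

/-- The Cameron–Martin formula for Gaussian noise. -/
lemma lintegral_noise_add {ι : Type*} [Fintype ι] (e : ι → ℝ) {f : (ι → ℝ) → ℝ≥0∞}
    (hf : Measurable f) :
    ∫⁻ z, f (z + e) ∂(noise ι)
      = ∫⁻ z, ENNReal.ofReal (Real.exp (∑ i, z i * e i - (∑ i, e i ^ 2) / 2)) * f z ∂(noise ι) := by
  have h1 : ∀ i, (gaussianReal 0 1).map (fun y => y + e i)
      = (gaussianReal 0 1).withDensity fun y => ENNReal.ofReal (Real.exp (y * e i - e i ^ 2 / 2)) := by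
    intro i
    rw [gaussianReal_map_add_const, zero_add, gaussianReal_of_var_ne_zero _ one_ne_zero,
      gaussianReal_of_var_ne_zero _ one_ne_zero, ← withDensity_mul _ (measurable_gaussianPDF _ _)
        (by fun_prop)]
    congr 1
    ext y
    exact gaussianPDF_shift (e i) y
  have hfin : ∀ i, IsProbabilityMeasure ((gaussianReal 0 1).withDensity
      fun y => ENNReal.ofReal (Real.exp (y * e i - e i ^ 2 / 2))) := fun i => by
    rw [← h1]; exact Measure.isProbabilityMeasure_map (by fun_prop)
  have h2 : (noise ι).map (fun z => z + e) = (noise ι).withDensity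
      fun z => ∏ i, ENNReal.ofReal (Real.exp (z i * e i - e i ^ 2 / 2)) := by
    rw [noise, ← pi_withDensity (fun _ : ι => gaussianReal 0 1)
      (f := fun i y => ENNReal.ofReal (Real.exp (y * e i - e i ^ 2 / 2))) (by fun_prop)]
    simp_rw [← h1]
    rw [← Measure.pi_map_pi (by fun_prop)]
    rfl
  rw [← lintegral_map hf (by fun_prop), h2,
    lintegral_withDensity_eq_lintegral_mul _ (by fun_prop) hf]
  refine lintegral_congr fun z => ?_
  rw [Pi.mul_apply, ← ENNReal.ofReal_prod_of_nonneg fun i _ => (Real.exp_pos _).le, ← Real.exp_sum,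
    Finset.sum_sub_distrib, Finset.sum_div]

end

section

variable {K d t : ℕ} (L : ℕ) (W : ℕ → Matrix (Fin d) (Fin d) ℝ) (s : ℕ → ℝ) (σ : ℝ)

/-! ### The posterior of an expected reward -/

lemma exists_dual_representer {ι : Type*} [Fintype ι] {n : ℕ} {c : ℝ} (hc : 0 ≤ c)
    (m : Fin n → (ι → ℝ) →ₗ[ℝ] ℝ) (φ : (ι → ℝ) →ₗ[ℝ] ℝ) :
    ∃ e : ι → ℝ, ∀ z, φ z = ∑ i, z i * e i + c * ∑ i, m i z * m i e := by
  let B : (ι → ℝ) →ₗ[ℝ] Module.Dual ℝ (ι → ℝ) :=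
    ∑ i, (LinearMap.proj i : (ι → ℝ) →ₗ[ℝ] ℝ).smulRight (LinearMap.proj i : (ι → ℝ) →ₗ[ℝ] ℝ)
      + c • ∑ i, (m i).smulRight (m i)
  have hB : ∀ e z, B e z = ∑ i, z i * e i + c * ∑ i, m i z * m i e := fun e z => by
    simp [B, LinearMap.sum_apply, mul_comm]
  have hinj : Function.Injective B := by
    refine (injective_iff_map_eq_zero B).mpr fun e he => ?_
    have h0 := hB e e
    rw [he, LinearMap.zero_apply] at h0
    have h1 : 0 ≤ c * ∑ i, m i e * m i e :=
      mul_nonneg hc (Finset.sum_nonneg fun i _ => mul_self_nonneg _)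
    have h2 : ∑ i, e i * e i = 0 :=
      le_antisymm (by linarith) (Finset.sum_nonneg fun i _ => mul_self_nonneg _)
    ext i
    exact mul_self_eq_zero.mp
      ((Finset.sum_eq_zero_iff_of_nonneg fun i _ => mul_self_nonneg (e i)).mp h2 i (Finset.mem_univ i))
  obtain ⟨e, he⟩ := (LinearMap.injective_iff_surjective_of_finrank_eq_finrank
    (Subspace.dual_finrank_eq (K := ℝ) (V := ι → ℝ)).symm).mp hinj φ
  exact ⟨e, fun z => by rw [← hB, he]⟩

/-- The effect of shifting the mean on a Gaussian density. -/
lemma gaussianPDF_add_mean (hσ : 0 < σ) (μ e y : ℝ) :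
    gaussianPDF (μ + e) (σ ^ 2).toNNReal y = ENNReal.ofReal (Real.exp
      ((σ ^ 2)⁻¹ * ((y - μ) * e - e ^ 2 / 2))) * gaussianPDF μ (σ ^ 2).toNNReal y := by
  rw [gaussianPDF, gaussianPDF, ← ENNReal.ofReal_mul (Real.exp_pos _).le,
    gaussianPDFReal, gaussianPDFReal, mul_left_comm, ← Real.exp_add,
    Real.coe_toNNReal _ (sq_nonneg σ)]
  congr 3
  field_simp
  ring

/-- Under the posterior, the expected reward of the arm `a` in the context `x` has the moment
generating function of a Gaussian law `N(κ, q)`. Its variance `q` is a value `⟨x, w⟩` at which the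
precision of the arm (prior plus data) is at most `q`: the data on the other arms and the
correlation between arms can only decrease it. -/
lemma exists_posterior_mgf {C : ℝ} (hC : 0 < C) (hσ : 0 < σ) {ι : Type*} [Fintype ι]
    {A : (ι → ℝ) →ₗ[ℝ] (Fin K → Vec d)} (hA : prior L W s = (noise ι).map A)
    (hAC : ∀ z a, ‖A z a‖ ^ 2 ≤ C * ∑ i, z i ^ 2) (h : History K d t) (x : Vec d) (a : Fin K) :
    ∃ (κ : ℝ) (w : Vec d),
      ‖w‖ ^ 2 / C + (σ ^ 2)⁻¹ * ∑ i with (h i).2.1 = a, inner ℝ (h i).1 w ^ 2 ≤ inner ℝ x w ∧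
      ∀ l : ℝ, ∫⁻ θ, ENNReal.ofReal (Real.exp (l * inner ℝ x (θ a))) ∂(dtsSample L W s σ h)
        = ENNReal.ofReal (Real.exp (l * κ + l ^ 2 * inner ℝ x w / 2)) := by
  have hσ2 : 0 < (σ ^ 2)⁻¹ := by positivity
  let ev : Vec d → Fin K → (ι → ℝ) →ₗ[ℝ] ℝ := fun x a =>
    (innerSL ℝ x).toLinearMap ∘ₗ LinearMap.proj a ∘ₗ A
  have hev : ∀ x a z, ev x a z = inner ℝ x (A z a) := fun _ _ _ => rfl
  let m : Fin t → (ι → ℝ) →ₗ[ℝ] ℝ := fun i => ev (h i).1 (h i).2.1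
  obtain ⟨e, he⟩ := exists_dual_representer hσ2.le m (ev x a)
  have hq : inner ℝ x (A e a) = ∑ i, e i ^ 2 + (σ ^ 2)⁻¹ * ∑ i, m i e ^ 2 := by
    rw [← hev, he]; simp only [sq]
  refine ⟨(σ ^ 2)⁻¹ * ∑ i, (h i).2.2 * m i e, A e a, ?_, fun l => ?_⟩
  · rw [hq]
    refine add_le_add ((div_le_iff₀' hC).mpr (hAC e a)) (mul_le_mul_of_nonneg_left ?_ hσ2.le)
    rw [Finset.sum_filter]
    refine Finset.sum_le_sum fun i _ => ?_
    split_ifs with hi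
    · simp only [m, hev, hi]; exact le_rfl
    · exact sq_nonneg _
  · have hAm : Measurable A := A.continuous_of_finiteDimensional.measurable
    have hl : Measurable fun z => lik σ h (A z) := (measurable_lik' σ h).comp hAm
    have hm : ∀ i, Measurable (m i) := fun i => (m i).continuous_of_finiteDimensional.measurable
    obtain ⟨h0, Cl, hCl, hle⟩ := (tame_lik σ hσ h).lintegral
      (m := fun _ : Unit => prior L W s) (measurable_lik' σ h)
    have h0 := h0 ()
    have h1 := ne_top_of_le_ne_top hCl (hle ())
    have hex : Measurable fun θ : Fin K → Vec d =>
        ENNReal.ofReal (Real.exp (l * inner ℝ x (θ a))) := by fun_prop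
    simp only [hA] at h0 h1
    rw [lintegral_map (measurable_lik' σ h) hAm] at h0 h1
    rw [dtsSample_eq L W s σ hσ, lintegral_bayes _ (measurable_lik' σ h) hex, hA,
      lintegral_map (measurable_lik' σ h) hAm,
      lintegral_map (f := fun θ => lik σ h θ * ENNReal.ofReal (Real.exp (l * inner ℝ x (θ a))))
        ((measurable_lik' σ h).mul hex) hAm]
    -- the likelihood after a shift of the noise by `l • e`
    have hshift : ∀ z, lik σ h (A (z + l • e)) = ENNReal.ofReal (Real.exp ((σ ^ 2)⁻¹ *
        ∑ i, (((h i).2.2 - m i z) * (l * m i e) - (l * m i e) ^ 2 / 2))) * lik σ h (A z) := by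
      intro z
      rw [Finset.mul_sum, Real.exp_sum, ENNReal.ofReal_prod_of_nonneg fun i _ => (Real.exp_pos _).le,
        lik_eq_prod, lik_eq_prod, ← Finset.prod_mul_distrib]
      refine Finset.prod_congr rfl fun i _ => ?_
      change gaussianPDF (m i (z + l • e)) _ _ = _ * gaussianPDF (m i z) _ _
      rw [map_add, map_smul, smul_eq_mul, gaussianPDF_add_mean σ hσ]
    let f : (ι → ℝ) → ℝ≥0∞ := fun z => ENNReal.ofReal (Real.exp
      ((∑ i, (l * e i) ^ 2) / 2 + (σ ^ 2)⁻¹ * ∑ i, m i z * (l * m i e))) * lik σ h (A z)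
    have hf : Measurable f := by
      refine Measurable.mul (Measurable.ennreal_ofReal ?_) hl
      exact Real.measurable_exp.comp (measurable_const.add (measurable_const.mul
        (Finset.measurable_sum _ fun i _ => (hm i).mul_const _)))
    have hcm := lintegral_noise_add (l • e) hf
    have hL : ∀ z, f (z + l • e) = ENNReal.ofReal (Real.exp
        (l * ((σ ^ 2)⁻¹ * ∑ i, (h i).2.2 * m i e) + l ^ 2 * inner ℝ x (A e a) / 2))
          * lik σ h (A z) := by
      intro z
      simp only [f]
      rw [hshift, ← mul_assoc, ← ENNReal.ofReal_mul (Real.exp_pos _).le, ← Real.exp_add, hq]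
      congr 3
      have e1 : ∑ i, (l * e i) ^ 2 = l ^ 2 * ∑ i, e i ^ 2 := by
        rw [Finset.mul_sum]; exact Finset.sum_congr rfl fun i _ => by ring
      have e2 : ∑ i, m i (z + l • e) * (l * m i e)
          + ∑ i, (((h i).2.2 - m i z) * (l * m i e) - (l * m i e) ^ 2 / 2)
          = l * ∑ i, (h i).2.2 * m i e + l ^ 2 / 2 * ∑ i, m i e ^ 2 := by
        rw [Finset.mul_sum, Finset.mul_sum, ← Finset.sum_add_distrib, ← Finset.sum_add_distrib]
        refine Finset.sum_congr rfl fun i _ => ?_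
        rw [map_add, map_smul, smul_eq_mul]
        ring
      linear_combination e1 / 2 + (σ ^ 2)⁻¹ * e2
    have hR : ∀ z, ENNReal.ofReal (Real.exp (∑ i, z i * (l • e) i - (∑ i, (l • e) i ^ 2) / 2)) * f z
        = lik σ h (A z) * ENNReal.ofReal (Real.exp (l * inner ℝ x (A z a))) := by
      intro z
      simp only [f]
      rw [← mul_assoc, ← ENNReal.ofReal_mul (Real.exp_pos _).le, ← Real.exp_add, mul_comm (lik σ h _),
        ← hev x a z, he]
      congr 3
      have e1 : ∑ i, z i * (l • e) i = l * ∑ i, z i * e i := by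
        rw [Finset.mul_sum]
        exact Finset.sum_congr rfl fun i _ => by rw [Pi.smul_apply, smul_eq_mul]; ring
      have e2 : ∑ i, m i z * (l * m i e) = l * ∑ i, m i z * m i e := by
        rw [Finset.mul_sum]; exact Finset.sum_congr rfl fun i _ => by ring
      simp only [Pi.smul_apply, smul_eq_mul] at e1 ⊢
      linear_combination e1 + (σ ^ 2)⁻¹ * e2
    simp_rw [hL, hR] at hcm
    rw [lintegral_const_mul _ hl] at hcm
    rw [← hcm, mul_left_comm, ENNReal.inv_mul_cancel h0 h1, mul_one]

/-! ### The design matrices -/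

/-- The precision of the arm `a` after the history `h`, relative to the prior covariance `C • 1`:
`1 + (C / σ²) ∑_{i : A_i = a} X_i X_iᵀ`. -/
noncomputable def design (C : ℝ) (h : History K d t) (a : Fin K) : Matrix (Fin d) (Fin d) ℝ :=
  1 + (C / σ ^ 2) • ∑ i with (h i).2.1 = a, Matrix.vecMulVec ((h i).1 : Fin d → ℝ) (h i).1

/-- An upper bound on the posterior variance of the expected reward of `a` in the context `x`. -/
noncomputable def varBound (C : ℝ) (h : History K d t) (x : Vec d) (a : Fin K) : ℝ :=
  C * ((x : Fin d → ℝ) ⬝ᵥ (design σ C h a)⁻¹.mulVec x)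

lemma posDef_design {C : ℝ} (hC : 0 < C) (h : History K d t) (a : Fin K) :
    (design σ C h a).PosDef := by
  refine Matrix.PosDef.one.add_posSemidef (Matrix.PosSemidef.smul ?_ (by positivity))
  exact Matrix.posSemidef_sum _ fun i _ => by
    simpa using Matrix.posSemidef_vecMulVec_self_star ((h i).1 : Fin d → ℝ)

lemma design_snoc (C : ℝ) (h : History K d t) (r : Round K d) (a : Fin K) :
    design σ C (Fin.snoc (α := fun _ => Round K d) h r : History K d (t + 1)) a
      = design σ C h a + if r.2.1 = a then
          (C / σ ^ 2) • Matrix.vecMulVec (r.1 : Fin d → ℝ) r.1 else 0 := by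
  simp only [design, Finset.sum_filter, Fin.sum_univ_castSucc, Fin.snoc_castSucc, Fin.snoc_last,
    smul_add, add_assoc, smul_ite, smul_zero]

lemma dotProduct_design (C : ℝ) (h : History K d t) (a : Fin K) (u w : Vec d) :
    (u : Fin d → ℝ) ⬝ᵥ (design σ C h a).mulVec w
      = inner ℝ u w + C / σ ^ 2 * ∑ i with (h i).2.1 = a, inner ℝ (h i).1 u * inner ℝ (h i).1 w := by
  have hi : ∀ u w : Vec d, inner ℝ u w = (u : Fin d → ℝ) ⬝ᵥ w := fun u w => by
    rw [EuclideanSpace.inner_eq_star_dotProduct, dotProduct_comm]; rfl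
  simp only [hi]
  rw [design, Matrix.add_mulVec, Matrix.one_mulVec, dotProduct_add, Matrix.smul_mulVec,
    dotProduct_smul, Matrix.sum_mulVec, dotProduct_sum, smul_eq_mul]
  congr 2
  refine Finset.sum_congr rfl fun i _ => ?_
  rw [Matrix.vecMulVec_mulVec, op_smul_eq_smul, dotProduct_smul, smul_eq_mul, mul_comm,
    dotProduct_comm (u : Fin d → ℝ)]

lemma exists_varBound_eq {C : ℝ} (hC : 0 < C) (h : History K d t) (x : Vec d) (a : Fin K) :
    ∃ y : Vec d, varBound σ C h x a = C * inner ℝ x y ∧ ∀ w, inner ℝ x w = inner ℝ y w +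
      C / σ ^ 2 * ∑ i with (h i).2.1 = a, inner ℝ (h i).1 y * inner ℝ (h i).1 w := by
  have hi : ∀ u w : Vec d, inner ℝ u w = (u : Fin d → ℝ) ⬝ᵥ w := fun u w => by
    rw [EuclideanSpace.inner_eq_star_dotProduct, dotProduct_comm]; rfl
  have hV := posDef_design σ hC h a
  refine ⟨WithLp.toLp 2 ((design σ C h a)⁻¹.mulVec x), by rw [hi]; rfl, fun w => ?_⟩
  have hs : ∀ y : Vec d, inner ℝ y w +
      C / σ ^ 2 * ∑ i with (h i).2.1 = a, inner ℝ (h i).1 y * inner ℝ (h i).1 w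
      = (w : Fin d → ℝ) ⬝ᵥ (design σ C h a).mulVec y := fun y => by
    rw [dotProduct_design, real_inner_comm]
    simp only [mul_comm]
  rw [hs, Matrix.mulVec_mulVec, Matrix.mul_nonsing_inv _ hV.det_pos.ne'.isUnit, Matrix.one_mulVec,
    real_inner_comm, hi]

lemma le_varBound {C : ℝ} (hC : 0 < C) (h : History K d t) (x w : Vec d) (a : Fin K)
    (hw : ‖w‖ ^ 2 / C + (σ ^ 2)⁻¹ * ∑ i with (h i).2.1 = a, inner ℝ (h i).1 w ^ 2 ≤ inner ℝ x w) :
    inner ℝ x w ≤ varBound σ C h x a := by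
  obtain ⟨y, hy, hxy⟩ := exists_varBound_eq σ hC h x a
  rw [hy]
  have h1 := hxy y
  have h2 := hxy w
  -- the design matrix is nonnegative at `C • y - w`
  have h3 : 0 ≤ ‖C • y - w‖ ^ 2 +
      C / σ ^ 2 * ∑ i with (h i).2.1 = a, (C * inner ℝ (h i).1 y - inner ℝ (h i).1 w) ^ 2 := by
    positivity
  have h4 : ∑ i with (h i).2.1 = a, (C * inner ℝ (h i).1 y - inner ℝ (h i).1 w) ^ 2
      = C ^ 2 * (∑ i with (h i).2.1 = a, inner ℝ (h i).1 y * inner ℝ (h i).1 y)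
        - 2 * C * (∑ i with (h i).2.1 = a, inner ℝ (h i).1 y * inner ℝ (h i).1 w)
        + ∑ i with (h i).2.1 = a, inner ℝ (h i).1 w ^ 2 := by
    rw [Finset.mul_sum, Finset.mul_sum, ← Finset.sum_sub_distrib, ← Finset.sum_add_distrib]
    exact Finset.sum_congr rfl fun i _ => by ring
  rw [h4, norm_sub_sq_real, norm_smul, Real.norm_of_nonneg hC.le, mul_pow, real_inner_smul_left,
    ← real_inner_self_eq_norm_sq y] at h3
  have h5 : ‖w‖ ^ 2 + C / σ ^ 2 * ∑ i with (h i).2.1 = a, inner ℝ (h i).1 w ^ 2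
      ≤ C * inner ℝ x w := by
    refine le_of_eq_of_le ?_ (mul_le_mul_of_nonneg_left hw hC.le)
    field_simp
  have h6 : C * inner ℝ x w ≤ C * (C * inner ℝ x y) := by
    linear_combination h3 + h5 - C ^ 2 * h1 + 2 * C * h2
  exact le_of_mul_le_mul_left h6 hC

lemma varBound_nonneg {C : ℝ} (hC : 0 < C) (h : History K d t) (x : Vec d) (a : Fin K) :
    0 ≤ varBound σ C h x a := by
  simpa using le_varBound σ hC h x 0 a (by simp)

lemma varBound_le {C : ℝ} (hC : 0 < C) (h : History K d t) (x : Vec d) (a : Fin K) :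
    varBound σ C h x a ≤ C * ‖x‖ ^ 2 := by
  obtain ⟨y, hy, hxy⟩ := exists_varBound_eq σ hC h x a
  rw [hy]
  refine mul_le_mul_of_nonneg_left ?_ hC.le
  have h1 := hxy y
  have h2 : 0 ≤ C / σ ^ 2 * ∑ i with (h i).2.1 = a, inner ℝ (h i).1 y * inner ℝ (h i).1 y :=
    mul_nonneg (by positivity) (Finset.sum_nonneg fun i _ => mul_self_nonneg _)
  rw [real_inner_self_eq_norm_sq] at h1
  nlinarith [real_inner_le_norm x y, sq_nonneg (‖x‖ - ‖y‖)]

lemma det_design_snoc {C : ℝ} (hC : 0 < C) (h : History K d t) (r : Round K d) :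
    (design σ C (Fin.snoc (α := fun _ => Round K d) h r : History K d (t + 1)) r.2.1).det
      = (design σ C h r.2.1).det * (1 + varBound σ C h r.1 r.2.1 / σ ^ 2) := by
  have hV := (posDef_design σ hC h r.2.1).det_pos.ne'.isUnit
  rw [design_snoc, if_pos rfl, ← Matrix.smul_vecMulVec, Matrix.vecMulVec_eq Unit,
    Matrix.det_add_replicateCol_mul_replicateRow hV, Matrix.mul_assoc, ← Matrix.replicateCol_mulVec,
    Matrix.det_unique (n := Unit), Matrix.add_apply, Matrix.one_apply_eq,
    Matrix.replicateRow_mul_replicateCol_apply, Matrix.mulVec_smul, dotProduct_smul, varBound,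
    smul_eq_mul]
  ring

lemma det_le_trace_div_pow (hd : 0 < d) {V : Matrix (Fin d) (Fin d) ℝ} (hV : V.PosSemidef) :
    V.det ≤ (V.trace / d) ^ d := by
  have hnn := hV.eigenvalues_nonneg
  have h1 := hV.isHermitian.det_eq_prod_eigenvalues
  have h2 := hV.isHermitian.trace_eq_sum_eigenvalues
  simp only [RCLike.ofReal_real_eq_id, id_eq] at h1 h2
  have hd' : (0 : ℝ) < d := Nat.cast_pos.mpr hd
  have h3 := Real.geom_mean_le_arith_mean Finset.univ (fun _ => 1) hV.isHermitian.eigenvalues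
    (fun _ _ => zero_le_one) (by simpa using hd) fun i _ => hnn i
  simp only [Real.rpow_one, one_mul, Finset.sum_const, Finset.card_univ, Fintype.card_fin,
    nsmul_eq_mul, mul_one] at h3
  rw [← h1, ← h2] at h3
  calc V.det = (V.det ^ ((d : ℝ)⁻¹)) ^ d := by
        rw [← Real.rpow_natCast, ← Real.rpow_mul hV.det_nonneg, inv_mul_cancel₀ hd'.ne',
          Real.rpow_one]
    _ ≤ _ := pow_le_pow_left₀ (Real.rpow_nonneg hV.det_nonneg _) h3 d

lemma det_design_le {C : ℝ} (hC : 0 < C) (hd : 0 < d) (h : History K d t)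
    (hX : ∀ i, ‖(h i).1‖ ^ 2 = 1) (a : Fin K) :
    (design σ C h a).det ≤ (1 + t * (C / σ ^ 2) / d) ^ d := by
  have hd' : (0 : ℝ) < d := Nat.cast_pos.mpr hd
  have hV := (posDef_design σ hC h a).posSemidef
  refine (det_le_trace_div_pow hd hV).trans
    (pow_le_pow_left₀ (div_nonneg hV.trace_nonneg hd'.le) ?_ d)
  have hx : ∀ i, Matrix.trace (Matrix.vecMulVec ((h i).1 : Fin d → ℝ) (h i).1) = 1 := fun i => by
    rw [Matrix.trace_vecMulVec, ← hX i, EuclideanSpace.real_norm_sq_eq]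
    simp [dotProduct, sq]
  have htr : (design σ C h a).trace ≤ d + t * (C / σ ^ 2) := by
    rw [design, Matrix.trace_add, Matrix.trace_one, Matrix.trace_smul, Matrix.trace_sum,
      Finset.sum_congr rfl fun i _ => hx i]
    simp only [Fintype.card_fin, Finset.sum_const, nsmul_eq_mul, mul_one, smul_eq_mul]
    rw [mul_comm]
    have : ((Finset.univ.filter fun i => (h i).2.1 = a).card : ℝ) ≤ t := by
      exact_mod_cast (Finset.card_filter_le _ _).trans (by simp)
    gcongr
  calc (design σ C h a).trace / d ≤ (d + t * (C / σ ^ 2)) / d := by gcongr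
    _ = _ := by rw [add_div, div_self hd'.ne']

end

section

/-! ### Thompson sampling from a posterior with Gaussian marginals -/

lemma integrable_exp_of_lintegral {Ω : Type*} [MeasurableSpace Ω] {μ : Measure Ω} {f : Ω → ℝ}
    (hf : Measurable f) {c : ℝ}
    (h : ∫⁻ ω, ENNReal.ofReal (Real.exp (f ω)) ∂μ = ENNReal.ofReal (Real.exp c)) :
    Integrable (fun ω => Real.exp (f ω)) μ ∧ ∫ ω, Real.exp (f ω) ∂μ = Real.exp c := by
  have h0 : 0 ≤ᵐ[μ] fun ω => Real.exp (f ω) := ae_of_all _ fun ω => (Real.exp_pos _).le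
  have hm : AEStronglyMeasurable (fun ω => Real.exp (f ω)) μ :=
    (Real.measurable_exp.comp hf).aestronglyMeasurable
  refine ⟨⟨hm, ?_⟩, ?_⟩
  · rw [hasFiniteIntegral_iff_ofReal h0, h]
    exact ENNReal.ofReal_lt_top
  · rw [integral_eq_lintegral_of_nonneg_ae h0 hm, h, ENNReal.toReal_ofReal (Real.exp_pos _).le]

/-- One round of posterior sampling. When `S` maximizes the rewards `g` and the parameters `θ` and
the sample `θt` are independent with the same law `μ`, under which the reward `g a` has the moment
generating function of `N(κ, q)` with `q ≤ v a`, the expected regret is at most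
`l 𝔼[v (S θt)] + (1 + log K) / l`. By symmetry the regret has the same mean as
`D = g (S θ) θ - g (S θ) θt`, and `l D - l² v` is bounded through its exponential moment, summed
over the arms. -/
lemma lintegral_regret_le {Ω : Type*} [MeasurableSpace Ω] (μ : Measure Ω) [IsProbabilityMeasure μ]
    {K : ℕ} {g : Fin K → Ω → ℝ} (hg : ∀ a, Measurable (g a)) {S : Ω → Fin K} (hS : Measurable S)
    (hmax : ∀ θ a, g a θ ≤ g (S θ) θ) {v : Fin K → ℝ} (hv : ∀ a, 0 ≤ v a)
    (hmgf : ∀ a, ∃ κ q : ℝ, q ≤ v a ∧ ∀ l : ℝ, ∫⁻ θ, ENNReal.ofReal (Real.exp (l * g a θ)) ∂μ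
      = ENNReal.ofReal (Real.exp (l * κ + l ^ 2 * q / 2)))
    {l : ℝ} (hl : 0 < l) :
    ∫⁻ θt, ∫⁻ θ, ENNReal.ofReal (g (S θ) θ - g (S θt) θ) ∂μ ∂μ
      ≤ ∫⁻ θt, ENNReal.ofReal (l * v (S θt) + (1 + Real.log K) / l) ∂μ := by
  obtain ⟨ω⟩ : Nonempty Ω := by
    by_contra hne
    rw [not_nonempty_iff] at hne
    exact IsProbabilityMeasure.ne_zero μ (Measure.eq_zero_of_isEmpty μ)
  have hK : 0 < K := (S ω).pos
  have hK1 : (1 : ℝ) ≤ K := by exact_mod_cast hK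
  have hK0 : (0 : ℝ) < K := by linarith
  have hM : 0 ≤ (1 + Real.log K) / l := by
    have := Real.log_nonneg hK1
    positivity
  have hSg : ∀ {β : Type _} [MeasurableSpace β] {f : Fin K → β → ℝ} (_ : ∀ a, Measurable (f a))
      {k : β → Fin K} (_ : Measurable k), Measurable fun b => f (k b) b := by
    intro β _ f hf k hk
    exact (measurable_from_prod_countable_right (f := fun p : Fin K × β => f p.1 p.2) hf).comp
      (hk.prodMk measurable_id)
  choose κ q hq hmgf using hmgf
  have hexp := fun a (l : ℝ) => integrable_exp_of_lintegral ((hg a).const_mul l) (hmgf a l)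
  have hgi : ∀ a, Integrable (g a) μ := fun a => by
    refine ((hexp a 1).1.add (hexp a (-1)).1).mono' (hg a).aestronglyMeasurable
      (ae_of_all _ fun θ => ?_)
    have h1 := Real.add_one_le_exp (g a θ)
    have h2 := Real.add_one_le_exp (-(g a θ))
    have h3 := Real.exp_pos (g a θ)
    have h4 := Real.exp_pos (-(g a θ))
    simp only [Pi.add_apply, one_mul, neg_one_mul, Real.norm_eq_abs]
    exact abs_le.mpr ⟨by linarith, by linarith⟩
  set ν := μ.prod μ
  -- `G₁ (θt, θ)` and `G₂ (θt, θ)` are the rewards of the best and of the sampled action,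
  -- and `G₃ (θt, θ)` is `G₂` with the two copies exchanged
  let H : Ω → ℝ := fun θ => ∑ a, |g a θ|
  have hH : Integrable H μ := integrable_finsetSum _ fun a _ => (hgi a).abs
  have hle : ∀ a θ, |g a θ| ≤ H θ := fun a θ =>
    Finset.single_le_sum (f := fun a => |g a θ|) (fun _ _ => abs_nonneg _) (Finset.mem_univ a)
  have hG1 : Integrable (fun p : Ω × Ω => g (S p.2) p.2) ν :=
    (hH.comp_snd μ).mono' (hSg (f := fun a (p : Ω × Ω) => g a p.2)
      (fun a => (hg a).comp measurable_snd) (hS.comp measurable_snd)).aestronglyMeasurable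
      (ae_of_all _ fun p => hle _ _)
  have hG2 : Integrable (fun p : Ω × Ω => g (S p.1) p.2) ν :=
    (hH.comp_snd μ).mono' (hSg (f := fun a (p : Ω × Ω) => g a p.2)
      (fun a => (hg a).comp measurable_snd) (hS.comp measurable_fst)).aestronglyMeasurable
      (ae_of_all _ fun p => hle _ _)
  have hG3 : Integrable (fun p : Ω × Ω => g (S p.2) p.1) ν := hG2.swap
  have hsw : ∫ p, g (S p.1) p.2 ∂ν = ∫ p, g (S p.2) p.1 ∂ν :=
    (integral_prod_swap (fun p : Ω × Ω => g (S p.1) p.2)).symm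
  have hu : Integrable (fun θ => l * v (S θ) + Real.log K / l) μ := by
    refine Integrable.add (Integrable.const_mul ?_ l) (integrable_const _)
    refine (integrable_const (∑ a, v a)).mono' ?_ (ae_of_all _ fun θ => ?_)
    · exact (hSg (f := fun a (_ : Ω) => v a) (fun a => measurable_const) hS).aestronglyMeasurable
    · rw [Real.norm_of_nonneg (hv _)]
      exact Finset.single_le_sum (fun a _ => hv a) (Finset.mem_univ _)
  have huv : (fun θ => l * v (S θ) + (1 + Real.log K) / l)
      = fun θ => (l * v (S θ) + Real.log K / l) + 1 / l := by
    ext θ; ring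
  let R : Fin K → Ω × Ω → ℝ := fun a p =>
    Real.exp (l * g a p.2 - l * g a p.1 - l ^ 2 * v a)
  have hR : ∀ a, Integrable (R a) ν ∧ ∫ p, R a p ∂ν ≤ 1 := fun a => by
    have e : R a = fun p => Real.exp (-l * g a p.1) * Real.exp (l * g a p.2)
        * Real.exp (-(l ^ 2 * v a)) := by
      ext p; simp only [R]; rw [← Real.exp_add, ← Real.exp_add]; ring_nf
    rw [e]
    refine ⟨((hexp a (-l)).1.mul_prod (hexp a l).1).mul_const _, ?_⟩
    rw [integral_mul_const, integral_prod_mul (fun θ => Real.exp (-l * g a θ))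
      (fun θ => Real.exp (l * g a θ)), (hexp a (-l)).2, (hexp a l).2, ← Real.exp_add,
      ← Real.exp_add, Real.exp_le_one_iff]
    nlinarith [mul_le_mul_of_nonneg_left (hq a) (sq_nonneg l)]
  have hRi : Integrable (fun p => (∑ a, R a p) / (K * l)) ν :=
    (integrable_finsetSum _ fun a _ => (hR a).1).div_const _
  have hRle : ∫ p, (∑ a, R a p) / (K * l) ∂ν ≤ 1 / l := by
    rw [integral_div, integral_finsetSum _ fun a _ => (hR a).1, div_le_div_iff₀ (by positivity) hl]
    have : ∑ a, ∫ p, R a p ∂ν ≤ ∑ _a : Fin K, (1 : ℝ) := Finset.sum_le_sum fun a _ => (hR a).2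
    rw [Finset.sum_const, Finset.card_univ, Fintype.card_fin, nsmul_eq_mul, mul_one] at this
    nlinarith
  have hpt : ∀ p : Ω × Ω, g (S p.2) p.2 - g (S p.2) p.1
      ≤ (l * v (S p.2) + Real.log K / l) + (∑ a, R a p) / (K * l) := fun p => by
    set a := S p.2
    have h1 : R a p ≤ ∑ a, R a p :=
      Finset.single_le_sum (f := fun b => R b p) (fun b _ => (Real.exp_pos _).le)
        (Finset.mem_univ a)
    -- the tangent to the exponential at `log K`
    have h2 : l * g a p.2 - l * g a p.1 - l ^ 2 * v a - Real.log K ≤ R a p / K := by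
      have := Real.add_one_le_exp (l * g a p.2 - l * g a p.1 - l ^ 2 * v a - Real.log K)
      rw [Real.exp_sub, Real.exp_log hK0] at this
      exact le_trans (by linarith) this
    have h3 : R a p / K ≤ (∑ a, R a p) / K := div_le_div_of_nonneg_right h1 hK0.le
    have h4 : g a p.2 - g a p.1 - (l * v a + Real.log K / l)
        = (l * g a p.2 - l * g a p.1 - l ^ 2 * v a - Real.log K) / l := by
      field_simp
      ring
    have h5 : (∑ a, R a p) / (K * l) = (∑ a, R a p) / K / l := by rw [div_div]
    rw [← sub_le_iff_le_add', h4, h5]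
    exact div_le_div_of_nonneg_right (h2.trans h3) hl.le
  have hfin : ∫ p, (g (S p.2) p.2 - g (S p.1) p.2) ∂ν
      ≤ ∫ θ, (l * v (S θ) + (1 + Real.log K) / l) ∂μ := by
    have e1 : ∫ p : Ω × Ω, (l * v (S p.2) + Real.log K / l) ∂ν
        = ∫ θ, (l * v (S θ) + Real.log K / l) ∂μ := by
      rw [integral_fun_snd (fun θ => l * v (S θ) + Real.log K / l)]
      simp
    have e2 : ∫ _θ, 1 / l ∂μ = 1 / l := by simp
    rw [integral_sub hG1 hG2, hsw, ← integral_sub hG1 hG3]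
    refine (integral_mono (hG1.sub hG3) ((hu.comp_snd μ).add hRi) hpt).trans ?_
    rw [integral_add' (hu.comp_snd μ) hRi, e1, huv, integral_add hu (integrable_const _), e2]
    linarith
  have hmeas : Measurable fun p : Ω × Ω => ENNReal.ofReal (g (S p.2) p.2 - g (S p.1) p.2) :=
    ((hSg (f := fun a (p : Ω × Ω) => g a p.2) (fun a => (hg a).comp measurable_snd)
      (hS.comp measurable_snd)).sub (hSg (f := fun a (p : Ω × Ω) => g a p.2)
      (fun a => (hg a).comp measurable_snd) (hS.comp measurable_fst))).ennreal_ofReal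
  calc ∫⁻ θt, ∫⁻ θ, ENNReal.ofReal (g (S θ) θ - g (S θt) θ) ∂μ ∂μ
      = ∫⁻ p, ENNReal.ofReal (g (S p.2) p.2 - g (S p.1) p.2) ∂ν :=
        (lintegral_prod _ hmeas.aemeasurable).symm
    _ = ENNReal.ofReal (∫ p, (g (S p.2) p.2 - g (S p.1) p.2) ∂ν) :=
        (ofReal_integral_eq_lintegral_ofReal (hG1.sub hG2)
          (ae_of_all _ fun p => sub_nonneg.mpr (hmax _ _))).symm
    _ ≤ ENNReal.ofReal (∫ θ, (l * v (S θ) + (1 + Real.log K) / l) ∂μ) :=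
        ENNReal.ofReal_le_ofReal hfin
    _ = _ := ofReal_integral_eq_lintegral_ofReal (huv ▸ hu.add (integrable_const _))
        (ae_of_all _ fun θ => add_nonneg (mul_nonneg hl.le (hv _)) hM)

variable {K d t : ℕ} (L : ℕ) (W : ℕ → Matrix (Fin d) (Fin d) ℝ) (s : ℕ → ℝ) (σ : ℝ)

/-! ### The potential -/

/-- The information gathered on all arms: the sum of the log-determinants of their designs. -/
noncomputable def potential (C : ℝ) (h : History K d t) : ℝ :=
  ∑ a, Real.log (design σ C h a).det

/-- The increase of the potential when `a` is played in the context `x`. -/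
noncomputable def potentialGain (C : ℝ) (h : History K d t) (x : Vec d) (a : Fin K) : ℝ :=
  Real.log (1 + varBound σ C h x a / σ ^ 2)

lemma potentialGain_nonneg {C : ℝ} (hC : 0 < C) (h : History K d t) (x : Vec d) (a : Fin K) :
    0 ≤ potentialGain σ C h x a :=
  Real.log_nonneg (le_add_of_nonneg_right (div_nonneg (varBound_nonneg σ hC h x a) (sq_nonneg σ)))

lemma potential_snoc {C : ℝ} (hC : 0 < C) (h : History K d t) (r : Round K d) :
    potential σ C (Fin.snoc (α := fun _ => Round K d) h r : History K d (t + 1))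
      = potential σ C h + potentialGain σ C h r.1 r.2.1 := by
  rw [potential, potential, ← Finset.add_sum_erase _ _ (Finset.mem_univ r.2.1),
    ← Finset.add_sum_erase _ _ (Finset.mem_univ r.2.1), det_design_snoc σ hC, potentialGain,
    Real.log_mul (posDef_design σ hC h _).det_pos.ne'
      (by have := varBound_nonneg σ hC h r.1 r.2.1; positivity)]
  have : ∑ a ∈ Finset.univ.erase r.2.1, Real.log (design σ C
      (Fin.snoc (α := fun _ => Round K d) h r : History K d (t + 1)) a).det
      = ∑ a ∈ Finset.univ.erase r.2.1, Real.log (design σ C h a).det := by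
    refine Finset.sum_congr rfl fun a ha => ?_
    rw [design_snoc, if_neg (Finset.ne_of_mem_erase ha).symm, add_zero]
  rw [this]
  ring

lemma potential_zero (C : ℝ) (h : History K d 0) : potential σ C h = 0 := by
  simp [potential, design]

lemma potential_nonneg {C : ℝ} (hC : 0 < C) (h : History K d t) : 0 ≤ potential σ C h := by
  induction t with
  | zero => rw [potential_zero]
  | succ t ih =>
    rw [← Fin.snoc_init_self h, potential_snoc σ hC]
    exact add_nonneg (ih _) (potentialGain_nonneg σ hC _ _ _)

lemma potential_le {C : ℝ} (hC : 0 < C) (hd : 0 < d) (h : History K d t)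
    (hX : ∀ i, ‖(h i).1‖ ^ 2 = 1) :
    potential σ C h ≤ K * (d * Real.log (1 + t * (C / σ ^ 2) / d)) := by
  refine (Finset.sum_le_sum fun a _ => (Real.log_le_log (posDef_design σ hC h a).det_pos
    (det_design_le σ hC hd h hX a)).trans_eq (Real.log_pow _ _)).trans_eq ?_
  simp

lemma varBound_le_potentialGain (hσ : 0 < σ) {C : ℝ} (hC : 0 < C) (h : History K d t) (x : Vec d)
    (hx : ‖x‖ ^ 2 = 1) (a : Fin K) :
    varBound σ C h x a ≤ (σ ^ 2 + C) * potentialGain σ C h x a := by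
  have h0 := varBound_nonneg σ hC h x a
  have h1 := varBound_le σ hC h x a
  rw [hx, mul_one] at h1
  have hσ2 : 0 < σ ^ 2 := by positivity
  have h2 : 0 < 1 + varBound σ C h x a / σ ^ 2 := by positivity
  have h3 := Real.one_sub_inv_le_log_of_pos h2
  refine le_trans ?_ (mul_le_mul_of_nonneg_right (add_le_add_right h1 (σ ^ 2))
    (potentialGain_nonneg σ hC h x a))
  calc varBound σ C h x a
      = (σ ^ 2 + varBound σ C h x a) * (1 - (1 + varBound σ C h x a / σ ^ 2)⁻¹) := by
        field_simp; ring
    _ ≤ _ := mul_le_mul_of_nonneg_left h3 (by positivity)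

lemma measurable_potential (C : ℝ) : Measurable (potential (K := K) (d := d) (t := t) σ C) := by
  refine Finset.measurable_sum _ fun a _ => Real.measurable_log.comp ?_
  simp only [Matrix.det_apply]
  refine Finset.measurable_sum _ fun τ _ => Measurable.const_smul
    (Finset.measurable_prod _ fun i _ => ?_) _
  have : ∀ i j, (fun h : History K d t => design σ C h a i j) = fun h =>
      (1 : Matrix (Fin d) (Fin d) ℝ) i j +
        C / σ ^ 2 * ∑ k, if (h k).2.1 = a then (h k).1 i * (h k).1 j else 0 := fun i j => by
    ext h
    simp only [design, Matrix.add_apply, Matrix.smul_apply, Matrix.sum_apply, Finset.sum_filter,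
      smul_eq_mul]
    congr 2
    refine Finset.sum_congr rfl fun k _ => ?_
    split_ifs
    · exact Matrix.vecMulVec_apply _ _ _ _
    · rfl
  rw [this]
  refine measurable_const.add (measurable_const.mul (Finset.measurable_sum _ fun k _ =>
    Measurable.ite ?_ (by fun_prop) measurable_const))
  exact (measurableSet_singleton a).preimage (f := fun h : History K d t => (h k).2.1)
    (by fun_prop)

lemma measurable_potentialGain {C : ℝ} (hC : 0 < C) :
    Measurable fun q : History K d t × Vec d × Fin K => potentialGain σ C q.1 q.2.1 q.2.2 := by
  have : (fun q : History K d t × Vec d × Fin K => potentialGain σ C q.1 q.2.1 q.2.2) = fun q =>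
      potential σ C (Fin.snoc (α := fun _ => Round K d) q.1 (q.2.1, q.2.2, 0) :
        History K d (t + 1)) - potential σ C q.1 := by
    ext q; rw [potential_snoc σ hC]; simp
  rw [this]
  exact ((measurable_potential σ C).comp (measurable_snoc.comp
    (f := fun q : History K d t × Vec d × Fin K => (q.1, (q.2.1, q.2.2, (0 : ℝ)))) (by fun_prop))).sub
    ((measurable_potential σ C).comp measurable_fst)

end

section

variable {K d t : ℕ} (L : ℕ) (W : ℕ → Matrix (Fin d) (Fin d) ℝ) (s : ℕ → ℝ) (σ : ℝ)

/-! ### The Bayes regret -/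

lemma meanReward_eq (x : Vec d) (a : Fin K) (θ : Fin K → Vec d) :
    meanReward σ x a θ = inner ℝ x (θ a) := by
  rw [meanReward, rewardDist, integral_id_gaussianReal]

/-- The regret of playing `a` in the context `x` under the parameters `θ`. -/
noncomputable def roundRegret (sel : Vec d → (Fin K → Vec d) → Fin K) (θ : Fin K → Vec d)
    (x : Vec d) (a : Fin K) : ℝ :=
  inner ℝ x (θ (sel x θ)) - inner ℝ x (θ a)

lemma IsArgmax.roundRegret_nonneg {sel : Vec d → (Fin K → Vec d) → Fin K} (hsel : IsArgmax σ sel)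
    (θ : Fin K → Vec d) (x : Vec d) (a : Fin K) : 0 ≤ roundRegret sel θ x a := by
  have := hsel.2 x θ a
  rw [meanReward_eq, meanReward_eq] at this
  exact sub_nonneg.mpr this

lemma regret_eq_sum {n : ℕ} (sel : Vec d → (Fin K → Vec d) → Fin K)
    (p : (Fin K → Vec d) × History K d n) :
    regret σ sel p = ∑ t, roundRegret sel p.1 (p.2 t).1 (p.2 t).2.1 := by
  simp only [regret, meanReward_eq, roundRegret]

lemma IsArgmax.regret_nonneg {n : ℕ} {sel : Vec d → (Fin K → Vec d) → Fin K}
    (hsel : IsArgmax σ sel) (p : (Fin K → Vec d) × History K d n) : 0 ≤ regret σ sel p := by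
  rw [regret_eq_sum]
  exact Finset.sum_nonneg fun t _ => hsel.roundRegret_nonneg σ _ _ _

lemma regret_succ {n : ℕ} (sel : Vec d → (Fin K → Vec d) → Fin K)
    (p : (Fin K → Vec d) × History K d (n + 1)) :
    regret σ sel p = regret σ sel (p.1, Fin.init (α := fun _ => Round K d) p.2)
      + roundRegret sel p.1 (p.2 (Fin.last n)).1 (p.2 (Fin.last n)).2.1 := by
  rw [regret_eq_sum, regret_eq_sum, Fin.sum_univ_castSucc]
  rfl

lemma measurable_roundRegret {sel : Vec d → (Fin K → Vec d) → Fin K}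
    (hsel : Measurable (Function.uncurry sel)) :
    Measurable fun q : (Fin K → Vec d) × Vec d × Fin K => roundRegret sel q.1 q.2.1 q.2.2 := by
  have h1 := measurable_apply_sel (f := fun q : (Fin K → Vec d) × Vec d × Fin K => q.1)
    measurable_fst (k := fun q => sel q.2.1 q.1)
    (hsel.comp (f := fun q : (Fin K → Vec d) × Vec d × Fin K => (q.2.1, q.1)) (by fun_prop))
  have h2 := measurable_apply_sel (f := fun q : (Fin K → Vec d) × Vec d × Fin K => q.1)
    measurable_fst (k := fun q => q.2.2) (by fun_prop)
  exact (measurable_snd.fst.inner h1).sub (measurable_snd.fst.inner h2)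

lemma measurable_regret {n : ℕ} {sel : Vec d → (Fin K → Vec d) → Fin K}
    (hsel : Measurable (Function.uncurry sel)) :
    Measurable (regret (n := n) σ sel) := by
  rw [funext (regret_eq_sum σ sel)]
  exact Finset.measurable_sum _ fun i _ => (measurable_roundRegret hsel).comp
    (f := fun p : (Fin K → Vec d) × History K d n => (p.1, (p.2 i).1, (p.2 i).2.1)) (by fun_prop)

section

variable (ctx : (t : ℕ) → Kernel (History K d t) (Vec d)) {sel : Vec d → (Fin K → Vec d) → Fin K}

lemma lintegral_law_succ_init (hσ : 0 < σ) (hctx : ∀ t, IsMarkovKernel (ctx t))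
    (hsel : Measurable (Function.uncurry sel)) (t : ℕ)
    {F : (Fin K → Vec d) × History K d t → ℝ≥0∞} (hF : Measurable F) :
    ∫⁻ z, F (z.1, Fin.init (α := fun _ => Round K d) z.2) ∂(law L W s σ ctx sel (t + 1))
      = ∫⁻ p, F p ∂(law L W s σ ctx sel t) := by
  have hd := dtsSample_good (K := K) (t := t) L W s σ hσ
  have := hd.2
  rw [lintegral_law_succ_round L W s σ ctx hσ hctx hsel t
    (F := fun q => F (q.1, q.2.1)) (hF.comp (by fun_prop)),
    lintegral_law_eq_lintegral_posterior L W s σ ctx hσ hctx hsel t hF]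
  simp

/-- A quantity accumulated over the rounds splits into the part of the first `t` rounds and the
part of the last round. -/
lemma lintegral_law_succ_add (hσ : 0 < σ) (hctx : ∀ t, IsMarkovKernel (ctx t))
    (hsel : Measurable (Function.uncurry sel)) (t : ℕ)
    {F : (Fin K → Vec d) × History K d t → ℝ≥0∞} (hF : Measurable F)
    {G : (Fin K → Vec d) × History K d t × Vec d × Fin K → ℝ≥0∞} (hG : Measurable G) :
    ∫⁻ z, (F (z.1, Fin.init (α := fun _ => Round K d) z.2) +
        G (z.1, Fin.init (α := fun _ => Round K d) z.2, (z.2 (Fin.last t)).1,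
          (z.2 (Fin.last t)).2.1)) ∂(law L W s σ ctx sel (t + 1))
      = ∫⁻ p, F p ∂(law L W s σ ctx sel t) + ∫⁻ p, ∫⁻ x, ∫⁻ θt, ∫⁻ θ, G (θ, p.2, x, sel x θt)
          ∂(dtsSample L W s σ p.2) ∂(dtsSample L W s σ p.2) ∂(ctx t p.2)
          ∂(law L W s σ ctx sel t) := by
  have hround : Measurable fun z : (Fin K → Vec d) × History K d (t + 1) =>
      (z.1, Fin.init (α := fun _ => Round K d) z.2, (z.2 (Fin.last t)).1,
        (z.2 (Fin.last t)).2.1) := by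
    refine measurable_fst.prodMk (Measurable.prodMk ?_ (by fun_prop))
    exact measurable_pi_iff.mpr fun i =>
      (measurable_pi_apply (Fin.castSucc i)).comp measurable_snd
  exact (lintegral_add_right _ (hG.comp hround)).trans (congrArg₂ (· + ·)
    (lintegral_law_succ_init L W s σ ctx hσ hctx hsel t hF)
    (lintegral_law_succ_round L W s σ ctx hσ hctx hsel t hG))

lemma ae_law_norm_sq_eq_one (hσ : 0 < σ) (hctx : ∀ t, IsMarkovKernel (ctx t))
    (hX : ∀ t h, ∀ᵐ x ∂(ctx t h), ‖x‖ ^ 2 = 1)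
    (hsel : Measurable (Function.uncurry sel)) (n : ℕ) :
    ∀ᵐ p ∂(law L W s σ ctx sel n), ∀ i, ‖(p.2 i).1‖ ^ 2 = 1 := by
  classical
  let b : Vec d → ℝ≥0∞ := fun x => if ‖x‖ ^ 2 = 1 then 0 else 1
  have hb : Measurable b :=
    Measurable.ite (measurableSet_eq_fun (by fun_prop) (by fun_prop)) measurable_const
      measurable_const
  have hB : ∀ n, Measurable fun p : (Fin K → Vec d) × History K d n => ∑ i, b (p.2 i).1 := fun n =>
    Finset.measurable_sum _ fun i _ => hb.comp (by fun_prop)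
  have key : ∫⁻ p, ∑ i, b (p.2 i).1 ∂(law L W s σ ctx sel n) = 0 := by
    induction n with
    | zero => simp
    | succ n ih =>
      have := hctx n
      have hd := dtsSample_good (K := K) (t := n) L W s σ hσ
      have := hd.2
      simp only [Fin.sum_univ_castSucc]
      refine (lintegral_law_succ_add L W s σ ctx hσ hctx hsel n (hB n) (G := fun q => b q.2.2.1)
        (hb.comp (by fun_prop))).trans ?_
      rw [ih, zero_add]
      simp only [lintegral_const, measure_univ, mul_one]
      refine (lintegral_congr fun p => ?_).trans lintegral_zero
      refine (lintegral_congr_ae ?_).trans lintegral_zero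
      filter_upwards [hX n p.2] with x hx
      exact if_pos hx
  rw [lintegral_eq_zero_iff (hB n)] at key
  filter_upwards [key] with p hp i
  have := (Finset.sum_eq_zero_iff.mp hp) i (Finset.mem_univ i)
  by_contra hne
  simp only [b, if_neg hne] at this
  exact one_ne_zero this

/-- The regret of a round is controlled by the information gained in that round. -/
lemma lintegral_roundRegret_le {C : ℝ} (hC : 0 < C) (hσ : 0 < σ) {ι : Type*} [Fintype ι]
    {A : (ι → ℝ) →ₗ[ℝ] (Fin K → Vec d)} (hA : prior L W s = (noise ι).map A)
    (hAC : ∀ z a, ‖A z a‖ ^ 2 ≤ C * ∑ i, z i ^ 2) (hsel : IsArgmax σ sel) (h : History K d t)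
    {x : Vec d} (hx : ‖x‖ ^ 2 = 1) {l : ℝ} (hl : 0 < l) :
    ∫⁻ θt, ∫⁻ θ, ENNReal.ofReal (roundRegret sel θ x (sel x θt))
        ∂(dtsSample L W s σ h) ∂(dtsSample L W s σ h)
      ≤ ∫⁻ θt, (ENNReal.ofReal ((1 + Real.log K) / l) + ENNReal.ofReal (l * (σ ^ 2 + C)) *
          ENNReal.ofReal (potentialGain σ C h x (sel x θt))) ∂(dtsSample L W s σ h) := by
  have := (dtsSample_good (K := K) (t := t) L W s σ hσ).2 h
  refine (lintegral_regret_le (dtsSample L W s σ h) (g := fun a θ => inner ℝ x (θ a))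
    (fun a => by fun_prop) (S := sel x) (hsel.1.of_uncurry_left) (fun θ a => ?_)
    (v := varBound σ C h x) (varBound_nonneg σ hC h x) (fun a => ?_) hl).trans
    (lintegral_mono fun θt => ?_)
  · have := hsel.2 x θ a
    rwa [meanReward_eq, meanReward_eq] at this
  · obtain ⟨κ, w, hw, hmgf⟩ := exists_posterior_mgf L W s σ hC hσ hA hAC h x a
    exact ⟨κ, inner ℝ x w, le_varBound σ hC h x w a hw, hmgf⟩
  · have h1 := varBound_le_potentialGain σ hσ hC h x hx (sel x θt)
    refine (ENNReal.ofReal_le_ofReal (add_le_add_left (mul_le_mul_of_nonneg_left h1 hl.le) _)).trans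
      ?_
    rw [add_comm, ← mul_assoc, ← ENNReal.ofReal_mul (by positivity)]
    exact ENNReal.ofReal_add_le

lemma lintegral_regret_le_potential {C : ℝ} (hC : 0 < C) (hσ : 0 < σ) {ι : Type*} [Fintype ι]
    {A : (ι → ℝ) →ₗ[ℝ] (Fin K → Vec d)} (hA : prior L W s = (noise ι).map A)
    (hAC : ∀ z a, ‖A z a‖ ^ 2 ≤ C * ∑ i, z i ^ 2) (hctx : ∀ t, IsMarkovKernel (ctx t))
    (hX : ∀ t h, ∀ᵐ x ∂(ctx t h), ‖x‖ ^ 2 = 1) (hsel : IsArgmax σ sel) {l : ℝ} (hl : 0 < l)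
    (n : ℕ) :
    ∫⁻ p, ENNReal.ofReal (regret σ sel p) ∂(law L W s σ ctx sel n)
      ≤ n * ENNReal.ofReal ((1 + Real.log K) / l) + ENNReal.ofReal (l * (σ ^ 2 + C)) *
          ∫⁻ p, ENNReal.ofReal (potential σ C p.2) ∂(law L W s σ ctx sel n) := by
  induction n with
  | zero => simp [regret]
  | succ n ih =>
    have := hctx n
    have hd := dtsSample_good (K := K) (t := n) L W s σ hσ
    have := hd.2
    have := isProbabilityMeasure_law L W s σ hσ ctx hctx hsel.1 n
    set M := ENNReal.ofReal ((1 + Real.log K) / l)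
    set c := ENNReal.ofReal (l * (σ ^ 2 + C))
    have hreg := (measurable_regret (n := n) σ hsel.1).ennreal_ofReal
    have hpot : Measurable fun p : (Fin K → Vec d) × History K d n =>
      ENNReal.ofReal (potential σ C p.2) :=
        ((measurable_potential σ C).comp measurable_snd).ennreal_ofReal
    have hrr : Measurable fun q : (Fin K → Vec d) × History K d n × Vec d × Fin K =>
        ENNReal.ofReal (roundRegret sel q.1 q.2.2.1 q.2.2.2) :=
      ((measurable_roundRegret hsel.1).comp (f := fun q : (Fin K → Vec d) × History K d n ×
        Vec d × Fin K => (q.1, q.2.2)) (by fun_prop)).ennreal_ofReal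
    have hgain : Measurable fun q : (Fin K → Vec d) × History K d n × Vec d × Fin K =>
        ENNReal.ofReal (potentialGain σ C q.2.1 q.2.2.1 q.2.2.2) :=
      ((measurable_potentialGain σ hC).comp (f := fun q : (Fin K → Vec d) × History K d n ×
        Vec d × Fin K => q.2) (by fun_prop)).ennreal_ofReal
    -- the regret and the potential both split into the first `n` rounds and the last one
    have e1 : ∫⁻ z, ENNReal.ofReal (regret σ sel z) ∂(law L W s σ ctx sel (n + 1))
        = ∫⁻ p, ENNReal.ofReal (regret σ sel p) ∂(law L W s σ ctx sel n)
          + ∫⁻ p, ∫⁻ x, ∫⁻ θt, ∫⁻ θ, ENNReal.ofReal (roundRegret sel θ x (sel x θt))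
            ∂(dtsSample L W s σ p.2) ∂(dtsSample L W s σ p.2) ∂(ctx n p.2)
            ∂(law L W s σ ctx sel n) := by
      refine (lintegral_congr fun z => ?_).trans
        (lintegral_law_succ_add L W s σ ctx hσ hctx hsel.1 n hreg hrr)
      rw [regret_succ, ENNReal.ofReal_add (hsel.regret_nonneg σ _) (hsel.roundRegret_nonneg σ _ _ _)]
    have e2 : ∫⁻ z, ENNReal.ofReal (potential σ C z.2) ∂(law L W s σ ctx sel (n + 1))
        = ∫⁻ p, ENNReal.ofReal (potential σ C p.2) ∂(law L W s σ ctx sel n)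
          + ∫⁻ p, ∫⁻ x, ∫⁻ θt, ENNReal.ofReal (potentialGain σ C p.2 x (sel x θt))
            ∂(dtsSample L W s σ p.2) ∂(ctx n p.2) ∂(law L W s σ ctx sel n) := by
      have h1 := lintegral_law_succ_add L W s σ ctx hσ hctx hsel.1 n hpot hgain
      simp only [lintegral_const, measure_univ, mul_one] at h1
      refine (lintegral_congr fun z => ?_).trans h1
      rw [← ENNReal.ofReal_add (potential_nonneg σ hC _) (potentialGain_nonneg σ hC _ _ _),
        ← potential_snoc σ hC, Fin.snoc_init_self]
    have e3 : ∫⁻ p, ∫⁻ x, ∫⁻ θt, ∫⁻ θ, ENNReal.ofReal (roundRegret sel θ x (sel x θt))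
            ∂(dtsSample L W s σ p.2) ∂(dtsSample L W s σ p.2) ∂(ctx n p.2)
            ∂(law L W s σ ctx sel n)
        ≤ ∫⁻ p, ∫⁻ x, ∫⁻ θt, (M + c * ENNReal.ofReal (potentialGain σ C p.2 x (sel x θt)))
            ∂(dtsSample L W s σ p.2) ∂(ctx n p.2) ∂(law L W s σ ctx sel n) := by
      refine lintegral_mono fun p => lintegral_mono_ae ?_
      filter_upwards [hX n p.2] with x hx
      exact lintegral_roundRegret_le L W s σ hC hσ hA hAC hsel p.2 hx hl
    have e4 : ∫⁻ p, ∫⁻ x, ∫⁻ θt, (M + c * ENNReal.ofReal (potentialGain σ C p.2 x (sel x θt)))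
            ∂(dtsSample L W s σ p.2) ∂(ctx n p.2) ∂(law L W s σ ctx sel n)
        = M + c * ∫⁻ p, ∫⁻ x, ∫⁻ θt, ENNReal.ofReal (potentialGain σ C p.2 x (sel x θt))
            ∂(dtsSample L W s σ p.2) ∂(ctx n p.2) ∂(law L W s σ ctx sel n) := by
      simp only [lintegral_const_mul' _ _ ENNReal.ofReal_ne_top, c,
        lintegral_add_left measurable_const, lintegral_const, measure_univ, mul_one]
    rw [e1, e2, mul_add, Nat.cast_succ, add_mul, one_mul]
    refine (add_le_add ih (e3.trans_eq e4)).trans_eq ?_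
    abel

/-- The Bayes regret of posterior sampling with a Gaussian prior of variance at most `C` in every
direction, with a free parameter `l`. -/
theorem bayesRegret_le {C : ℝ} (hC : 0 < C) (hσ : 0 < σ) (hd : 0 < d) {ι : Type*} [Fintype ι]
    {A : (ι → ℝ) →ₗ[ℝ] (Fin K → Vec d)} (hA : prior L W s = (noise ι).map A)
    (hAC : ∀ z a, ‖A z a‖ ^ 2 ≤ C * ∑ i, z i ^ 2) (hctx : ∀ t, IsMarkovKernel (ctx t))
    (hX : ∀ t h, ∀ᵐ x ∂(ctx t h), ‖x‖ ^ 2 = 1) (hsel : IsArgmax σ sel) (n : ℕ) :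
    Integrable (regret σ sel) (law L W s σ ctx sel n) ∧ ∀ l : ℝ, 0 < l →
      bayesRegret L W s σ ctx sel n ≤ n * (1 + Real.log K) / l +
        l * ((σ ^ 2 + C) * (K * (d * Real.log (1 + n * (C / σ ^ 2) / d)))) := by
  have := isProbabilityMeasure_law L W s σ hσ ctx hctx hsel.1 n
  set P := K * (d * Real.log (1 + n * (C / σ ^ 2) / d)) with hP
  have hP0 : 0 ≤ P := by
    have : 0 ≤ Real.log (1 + n * (C / σ ^ 2) / d) :=
      Real.log_nonneg (le_add_of_nonneg_right (by positivity))
    positivity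
  have hK : 0 ≤ 1 + Real.log K := by
    have := Real.log_natCast_nonneg K
    linarith
  have hpot : ∫⁻ p, ENNReal.ofReal (potential σ C p.2) ∂(law L W s σ ctx sel n)
      ≤ ENNReal.ofReal P := by
    refine (lintegral_mono_ae ?_).trans_eq
      (by simp : ∫⁻ _, ENNReal.ofReal P ∂(law L W s σ ctx sel n) = ENNReal.ofReal P)
    filter_upwards [ae_law_norm_sq_eq_one L W s σ ctx hσ hctx hX hsel.1 n] with p hp
    exact ENNReal.ofReal_le_ofReal (potential_le σ hC hd p.2 hp)
  have hbound : ∀ l : ℝ, 0 < l → ∫⁻ p, ENNReal.ofReal (regret σ sel p) ∂(law L W s σ ctx sel n)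
      ≤ ENNReal.ofReal (n * (1 + Real.log K) / l + l * ((σ ^ 2 + C) * P)) := fun l hl => by
    refine (lintegral_regret_le_potential L W s σ ctx hC hσ hA hAC hctx hX hsel hl n).trans
      ((add_le_add_right (mul_le_mul_right hpot _) _).trans_eq ?_)
    rw [← ENNReal.ofReal_mul (by positivity), ← ENNReal.ofReal_natCast n,
      ← ENNReal.ofReal_mul (by positivity), ← ENNReal.ofReal_add (by positivity) (by positivity),
      mul_div_assoc, mul_assoc]
  have h0 : 0 ≤ᵐ[law L W s σ ctx sel n] regret σ sel := ae_of_all _ fun p => hsel.regret_nonneg σ p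
  have hm : AEStronglyMeasurable (regret σ sel) (law L W s σ ctx sel n) :=
    (measurable_regret σ hsel.1).aestronglyMeasurable
  refine ⟨⟨hm, ?_⟩, fun l hl => ?_⟩
  · rw [hasFiniteIntegral_iff_ofReal h0]
    exact (hbound 1 one_pos).trans_lt ENNReal.ofReal_lt_top
  · rw [bayesRegret, integral_eq_lintegral_of_nonneg_ae h0 hm]
    exact ENNReal.toReal_le_of_le_ofReal (by positivity) (hbound l hl)

end

end

section

variable {K d : ℕ} (L : ℕ) (W : ℕ → Matrix (Fin d) (Fin d) ℝ) (s : ℕ → ℝ) (σ : ℝ)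

/-! ### Comparison of the constants -/

lemma TopEigenvalueOne.dim_pos {W : Matrix (Fin d) (Fin d) ℝ} (hW : TopEigenvalueOne W) :
    0 < d := by
  rcases Nat.eq_zero_or_pos d with rfl | h
  · obtain ⟨v, hv⟩ := Module.End.HasEigenvalue.exists_hasEigenvector hW.1
    exact (hv.2 (Subsingleton.elim _ _)).elim
  · exact h

lemma le_two_mul_sqrt_of_forall {B a b : ℝ} (ha : 0 < a) (hb : 0 < b)
    (h : ∀ l : ℝ, 0 < l → B ≤ a / l + l * b) : B ≤ 2 * √(a * b) := by
  have hsa := Real.sqrt_pos.mpr ha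
  have hsb := Real.sqrt_pos.mpr hb
  refine (h (√a / √b) (by positivity)).trans_eq ?_
  rw [Real.sqrt_mul ha.le]
  have h1 : a / (√a / √b) = √a * √b := by
    rw [div_div_eq_mul_div, div_eq_iff hsa.ne', mul_right_comm, Real.mul_self_sqrt ha.le]
  have h2 : √a / √b * b = √a * √b := by
    rw [div_mul_eq_mul_div, div_eq_iff hsb.ne', mul_assoc, Real.mul_self_sqrt hb.le]
  rw [h1, h2]
  ring

lemma log_one_add_mul_le {r y : ℝ} (hr : 1 ≤ r) (hy : 0 ≤ y) :
    Real.log (1 + r * y) ≤ r * Real.log (1 + y) := by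
  rw [← Real.log_rpow (by positivity)]
  exact Real.log_le_log (by positivity) (one_add_mul_self_le_rpow_one_add (by linarith) hr)

/-- The total prior variance `∑ s_ℓ²`, which bounds the prior variance of a parameter in every
direction. -/
noncomputable def totalVar : ℝ := ∑ ℓ ∈ Finset.Icc 1 (L + 1), s ℓ ^ 2

lemma totalVar_pos (hs : ∀ ℓ ∈ Finset.Icc 1 (L + 1), 0 < s ℓ) : 0 < totalVar L s :=
  Finset.sum_pos (fun ℓ hℓ => pow_pos (hs ℓ hℓ) 2) (Finset.nonempty_Icc.mpr (by omega))

section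

variable {L W s σ} {ctx : (t : ℕ) → Kernel (History K d t) (Vec d)}
  {sel : Vec d → (Fin K → Vec d) → Fin K}

theorem integrable_regret_and_bayesRegret_le (hL : 1 ≤ L) (hσ : 0 < σ)
    (hs : ∀ ℓ ∈ Finset.Icc 1 (L + 1), 0 < s ℓ)
    (hW : ∀ ℓ ∈ Finset.Icc 1 L, TopEigenvalueOne (W ℓ)) (hctx : ∀ t, IsMarkovKernel (ctx t))
    (hX : ∀ t h, ∀ᵐ x ∂(ctx t h), ‖x‖ ^ 2 = 1) (hsel : IsArgmax σ sel) (n : ℕ) :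
    Integrable (regret σ sel) (law L W s σ ctx sel n) ∧ ∀ l : ℝ, 0 < l →
      bayesRegret L W s σ ctx sel n ≤ n * (1 + Real.log K) / l +
        l * ((σ ^ 2 + totalVar L s) *
          (K * (d * Real.log (1 + n * (totalVar L s / σ ^ 2) / d)))) := by
  obtain ⟨ι, _, A, hA, hAC⟩ := prior_eq_map_noise (K := K) L W s hL hs hW
  exact bayesRegret_le L W s σ ctx (totalVar_pos L s hs) hσ
    (hW 1 (Finset.mem_Icc.mpr ⟨le_rfl, hL⟩)).dim_pos hA hAC hctx hX hsel n

/-- The regret bound after optimizing the free parameter. -/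
theorem bayesRegret_le_two_mul_sqrt (hL : 1 ≤ L) (hσ : 0 < σ)
    (hs : ∀ ℓ ∈ Finset.Icc 1 (L + 1), 0 < s ℓ)
    (hW : ∀ ℓ ∈ Finset.Icc 1 L, TopEigenvalueOne (W ℓ)) (hctx : ∀ t, IsMarkovKernel (ctx t))
    (hX : ∀ t h, ∀ᵐ x ∂(ctx t h), ‖x‖ ^ 2 = 1) (hsel : IsArgmax σ sel) (n : ℕ) :
    bayesRegret L W s σ ctx sel n ≤ 2 * √(n * (1 + Real.log K) * ((σ ^ 2 + totalVar L s) *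
          (K * (d * Real.log (1 + n * (totalVar L s / σ ^ 2) / d))))) := by
  rcases Nat.eq_zero_or_pos n with rfl | hn
  · simp [bayesRegret, regret]
  have hd : 0 < d := (hW 1 (Finset.mem_Icc.mpr ⟨le_rfl, hL⟩)).dim_pos
  have hK : 0 < K := (sel 0 0).pos
  have hC := totalVar_pos L s hs
  have hlog : 0 < Real.log (1 + n * (totalVar L s / σ ^ 2) / d) :=
    Real.log_pos (lt_add_of_pos_right _ (by positivity))
  have hlK := Real.log_natCast_nonneg K
  exact le_two_mul_sqrt_of_forall (by positivity) (by positivity)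
    (integrable_regret_and_bayesRegret_le hL hσ hs hW hctx hX hsel n).2

end

lemma sigmaMaxSq_nonneg : 0 ≤ sigmaMaxSq L s σ := by
  have h1 : (1 : ℕ) ∈ Finset.Icc 1 (L + 1) := Finset.mem_Icc.mpr ⟨le_rfl, by omega⟩
  have := Finset.le_sup' (fun ℓ => 1 + s ℓ ^ 2 / σ ^ 2) h1
  exact le_trans (by positivity) this

lemma latTerm_nonneg (dl : ℕ → ℕ) (ℓ : ℕ) : 0 ≤ latTerm L s σ dl ℓ := by
  have h1 : 0 ≤ Real.log (1 + s (ℓ + 1) ^ 2) :=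
    Real.log_nonneg (le_add_of_nonneg_right (sq_nonneg _))
  have h2 : 0 ≤ Real.log (1 + s (ℓ + 1) ^ 2 / s ℓ ^ 2) :=
    Real.log_nonneg (le_add_of_nonneg_right (by positivity))
  have h3 := sigmaMaxSq_nonneg L s σ
  unfold latTerm
  positivity

/-- The information gain of the arms is at most a constant multiple of the action term. -/
lemma infoGain_le_actTerm (hs1 : 0 < s 1) {v : ℝ} (hv : 0 ≤ v) (n : ℕ) :
    K * (d * Real.log (1 + n * v / d))
      ≤ max 1 (v / s 1 ^ 2) * (Real.log (1 + s 1 ^ 2) / s 1 ^ 2) * actTerm K d n s := by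
  set r := max 1 (v / s 1 ^ 2)
  have hs2 : 0 < s 1 ^ 2 := by positivity
  have hlog : 0 < Real.log (1 + s 1 ^ 2) := Real.log_pos (by linarith)
  have hvr : v ≤ r * s 1 ^ 2 := (div_le_iff₀ hs2).mp (le_max_right _ _)
  have h1 : Real.log (1 + n * v / d) ≤ r * Real.log (1 + n * s 1 ^ 2 / d) := by
    refine le_trans (Real.log_le_log (by positivity) ?_)
      (log_one_add_mul_le (le_max_left _ _) (by positivity))
    rw [← mul_div_assoc, mul_left_comm]
    gcongr
  calc K * (d * Real.log (1 + n * v / d))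
      ≤ K * (d * (r * Real.log (1 + n * s 1 ^ 2 / d))) := by gcongr
    _ = _ := by
      rw [actTerm]
      field_simp

lemma infoGain_le_linear (hd : 0 < d) {v : ℝ} (hv : 0 ≤ v) (n : ℕ) :
    K * (d * Real.log (1 + n * v / d)) ≤ n * (K * v) := by
  have hd' : (0 : ℝ) < d := Nat.cast_pos.mpr hd
  have h1 : Real.log (1 + n * v / d) ≤ n * v / d := by
    have := Real.log_le_sub_one_of_pos (show 0 < 1 + n * v / d by positivity)
    linarith
  calc K * (d * Real.log (1 + n * v / d)) ≤ K * (d * (n * v / d)) := by gcongr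
    _ = _ := by field_simp

lemma log_one_add_mul_div_le (hK : 0 < K) (hd : 0 < d) {v : ℝ} (hv : 0 ≤ v) {n : ℕ} (hn : 0 < n) :
    Real.log (1 + n * v / d) ≤ (1 + Real.log (1 + v)) * (1 + Real.log (n * K)) := by
  have hd' : (1 : ℝ) ≤ d := Nat.one_le_cast.mpr hd
  have hn' : (1 : ℝ) ≤ n := Nat.one_le_cast.mpr hn
  have hK' : (1 : ℝ) ≤ K := Nat.one_le_cast.mpr hK
  have h1 : (1 : ℝ) + n * v / d ≤ n * (1 + v) := by
    have : n * v / d ≤ n * v := div_le_self (by positivity) hd'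
    nlinarith
  have h2 : Real.log n ≤ Real.log (n * K) :=
    Real.log_le_log (by linarith) (le_mul_of_one_le_right (by linarith) hK')
  have h3 : 0 ≤ Real.log n := Real.log_nonneg hn'
  have h4 : 0 ≤ Real.log (1 + v) := Real.log_nonneg (by linarith)
  refine (Real.log_le_log (by positivity) h1).trans ?_
  rw [Real.log_mul (by positivity) (by positivity)]
  nlinarith [mul_nonneg h4 (h3.trans h2)]

end

end DiffusionTS

theorem mainTheorem2 (L : ℕ) (hL : 1 ≤ L) (σ : ℝ) (hσ : 0 < σ) (s : ℕ → ℝ)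
    (hs : ∀ ℓ ∈ Finset.Icc 1 (L + 1), 0 < s ℓ) :
    (∀ K : ℕ, ∃ c : ℝ, 0 < c ∧
      ∀ (d : ℕ) (dl : ℕ → ℕ) (W : ℕ → Matrix (Fin d) (Fin d) ℝ)
        (ctx : (t : ℕ) → Kernel (DiffusionTS.History K d t) (DiffusionTS.Vec d))
        (sel : DiffusionTS.Vec d → (Fin K → DiffusionTS.Vec d) → Fin K),
        (∀ ℓ ∈ Finset.Icc 1 L, DiffusionTS.TopEigenvalueOne (W ℓ)) →
        (∀ ℓ ∈ Finset.Icc 1 L, DiffusionTS.ColumnSparse (dl ℓ) (W ℓ)) →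
        (∀ t, IsMarkovKernel (ctx t)) →
        (∀ t h, ∀ᵐ x ∂(ctx t h), ‖x‖ ^ 2 = 1) →
        DiffusionTS.IsArgmax σ sel →
        ∀ n : ℕ,
          Integrable (DiffusionTS.regret σ sel) (DiffusionTS.law L W s σ ctx sel n) ∧
          ∀ δ ∈ Set.Ioo (0 : ℝ) 1,
            DiffusionTS.bayesRegret L W s σ ctx sel n ≤
              Real.sqrt (2 * n *
                (DiffusionTS.actTerm K d n s +
                  ∑ ℓ ∈ Finset.Icc 1 L, DiffusionTS.latTerm L s σ dl ℓ) *
                Real.log (1 / δ)) + c * n * δ) ∧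
    (∃ (C : ℝ) (m : ℕ), 0 < C ∧
      ∀ (K d : ℕ) (dl : ℕ → ℕ) (W : ℕ → Matrix (Fin d) (Fin d) ℝ)
        (ctx : (t : ℕ) → Kernel (DiffusionTS.History K d t) (DiffusionTS.Vec d))
        (sel : DiffusionTS.Vec d → (Fin K → DiffusionTS.Vec d) → Fin K),
        (∀ ℓ ∈ Finset.Icc 1 L, DiffusionTS.TopEigenvalueOne (W ℓ)) →
        (∀ ℓ ∈ Finset.Icc 1 L, DiffusionTS.ColumnSparse (dl ℓ) (W ℓ)) →
        (∀ t, IsMarkovKernel (ctx t)) →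
        (∀ t h, ∀ᵐ x ∂(ctx t h), ‖x‖ ^ 2 = 1) →
        DiffusionTS.IsArgmax σ sel →
        ∀ n : ℕ,
          DiffusionTS.bayesRegret L W s σ ctx sel n ≤
            C * (1 + Real.log (n * K)) ^ m *
              Real.sqrt (n * (d * K * s 1 ^ 2 +
                ∑ ℓ ∈ Finset.Icc 1 L, dl ℓ * s (ℓ + 1) ^ 2 * DiffusionTS.sigmaMaxSq L s σ ^ ℓ))) := by
  have hV := DiffusionTS.totalVar_pos L s hs
  have hs1 : 0 < s 1 := hs 1 (Finset.mem_Icc.mpr ⟨le_rfl, by omega⟩)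
  set V := DiffusionTS.totalVar L s
  have hs2 : 0 < s 1 ^ 2 := by positivity
  have hσ2 : 0 < σ ^ 2 := by positivity
  have hlog1 : 0 < Real.log (1 + s 1 ^ 2) := Real.log_pos (by linarith)
  constructor
  · intro K
    have hlK := Real.log_natCast_nonneg K
    -- the regret per round is at most `c₁`, and the square root dominates once `log (1 / δ) ≥ Λ`
    set ρ := max 1 (V / σ ^ 2 / s 1 ^ 2) * (Real.log (1 + s 1 ^ 2) / s 1 ^ 2)
    set c₁ := 1 + Real.log K + (σ ^ 2 + V) * (K * (V / σ ^ 2))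
    set Λ := 2 * (1 + Real.log K) * (σ ^ 2 + V) * ρ
    have hρ : 0 ≤ ρ := mul_nonneg (zero_le_one.trans (le_max_left _ _)) (by positivity)
    have hc₁ : 0 < c₁ := by positivity
    refine ⟨c₁ * Real.exp Λ, by positivity, ?_⟩
    intro d dl W ctx sel hW _ hctx hX hsel n
    have hmain := DiffusionTS.integrable_regret_and_bayesRegret_le hL hσ hs hW hctx hX hsel n
    refine ⟨hmain.1, fun δ hδ => ?_⟩
    rcases le_total (Real.exp (-Λ)) δ with hle | hle
    · have h1 := hmain.2 1 one_pos
      rw [div_one, one_mul] at h1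
      have hd := (hW 1 (Finset.mem_Icc.mpr ⟨le_rfl, hL⟩)).dim_pos
      have h2 := mul_le_mul_of_nonneg_left
        (DiffusionTS.infoGain_le_linear (K := K) hd (div_nonneg hV.le hσ2.le) n)
        (add_nonneg hσ2.le hV.le)
      have h3 : c₁ * n ≤ c₁ * Real.exp Λ * n * δ := by
        have h4 : 1 ≤ Real.exp Λ * δ := by
          have := mul_le_mul_of_nonneg_left hle (Real.exp_pos Λ).le
          rwa [← Real.exp_add, add_neg_cancel, Real.exp_zero] at this
        calc c₁ * n = c₁ * n * 1 := (mul_one _).symm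
          _ ≤ c₁ * n * (Real.exp Λ * δ) := by gcongr
          _ = _ := by ring
      refine le_trans ?_ (le_add_of_nonneg_left (Real.sqrt_nonneg _))
      refine (h1.trans (add_le_add_right h2 _)).trans (le_of_eq_of_le ?_ h3)
      simp only [c₁]
      ring
    · have hΛ : Λ ≤ Real.log (1 / δ) := by
        rw [one_div, Real.log_inv, le_neg, ← Real.log_exp (-Λ)]
        exact Real.log_le_log hδ.1 hle
      have hΛ0 : 0 ≤ Λ := by positivity
      have hlat : 0 ≤ ∑ ℓ ∈ Finset.Icc 1 L, DiffusionTS.latTerm L s σ dl ℓ :=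
        Finset.sum_nonneg fun ℓ _ => DiffusionTS.latTerm_nonneg L s σ dl ℓ
      have hact : 0 ≤ DiffusionTS.actTerm K d n s := by
        have : 0 ≤ Real.log (1 + n * s 1 ^ 2 / d) :=
          Real.log_nonneg (le_add_of_nonneg_right (by positivity))
        unfold DiffusionTS.actTerm
        positivity
      refine le_trans ?_ (le_add_of_nonneg_right (mul_nonneg (by positivity) hδ.1.le))
      refine (DiffusionTS.bayesRegret_le_two_mul_sqrt hL hσ hs hW hctx hX hsel n).trans ?_
      have h2 : ∀ z : ℝ, 2 * √z = √(2 ^ 2 * z) := fun z => by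
        rw [Real.sqrt_mul (sq_nonneg _), Real.sqrt_sq zero_le_two]
      rw [h2]
      refine Real.sqrt_le_sqrt ?_
      have h1 := DiffusionTS.infoGain_le_actTerm (K := K) (d := d) s hs1
        (div_nonneg hV.le hσ2.le) n
      calc (2 : ℝ) ^ 2 * (n * (1 + Real.log K) * ((σ ^ 2 + V) *
            (K * (d * Real.log (1 + n * (V / σ ^ 2) / d)))))
          ≤ (2 : ℝ) ^ 2 * (n * (1 + Real.log K) * ((σ ^ 2 + V) *
            (ρ * DiffusionTS.actTerm K d n s))) := by gcongr
        _ = 2 * n * DiffusionTS.actTerm K d n s * Λ := by simp only [Λ]; ring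
        _ ≤ _ := by
          gcongr
          exact le_add_of_nonneg_right hlat
  · have hlv : 0 ≤ Real.log (1 + V / σ ^ 2) :=
      Real.log_nonneg (le_add_of_nonneg_right (by positivity))
    set D := (σ ^ 2 + V) * (1 + Real.log (1 + V / σ ^ 2)) / s 1 ^ 2
    have hD : 0 < D := by positivity
    refine ⟨2 * √D, 1, by positivity, ?_⟩
    intro K d dl W ctx sel hW _ hctx hX hsel n
    refine (DiffusionTS.bayesRegret_le_two_mul_sqrt hL hσ hs hW hctx hX hsel n).trans ?_
    rcases Nat.eq_zero_or_pos n with rfl | hn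
    · simp
    have hd := (hW 1 (Finset.mem_Icc.mpr ⟨le_rfl, hL⟩)).dim_pos
    have hK : 0 < K := (sel 0 0).pos
    have hK' : (1 : ℝ) ≤ K := Nat.one_le_cast.mpr hK
    have hn' : (1 : ℝ) ≤ n := Nat.one_le_cast.mpr hn
    have hlK := Real.log_natCast_nonneg K
    have hnK : Real.log K ≤ Real.log (n * K) :=
      Real.log_le_log (by linarith) (le_mul_of_one_le_left (by linarith) hn')
    have hlog := DiffusionTS.log_one_add_mul_div_le hK hd (div_nonneg hV.le hσ2.le) hn
    have hlog0 : 0 ≤ Real.log (1 + n * (V / σ ^ 2) / d) :=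
      Real.log_nonneg (le_add_of_nonneg_right (by positivity))
    set y := 1 + Real.log (n * K)
    have hy : 0 ≤ y := by simp only [y]; linarith
    have hy1 : 1 + Real.log K ≤ y := by simp only [y]; linarith
    have hlat : 0 ≤ ∑ ℓ ∈ Finset.Icc 1 L,
        (dl ℓ : ℝ) * s (ℓ + 1) ^ 2 * DiffusionTS.sigmaMaxSq L s σ ^ ℓ :=
      Finset.sum_nonneg fun ℓ _ => by
        have := DiffusionTS.sigmaMaxSq_nonneg L s σ
        positivity
    clear_value y
    have key : n * (1 + Real.log K) * ((σ ^ 2 + V) *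
          (K * (d * Real.log (1 + n * (V / σ ^ 2) / d))))
        ≤ D * y ^ 2 * (n * (d * K * s 1 ^ 2 + ∑ ℓ ∈ Finset.Icc 1 L,
          (dl ℓ : ℝ) * s (ℓ + 1) ^ 2 * DiffusionTS.sigmaMaxSq L s σ ^ ℓ)) := by
      calc n * (1 + Real.log K) * ((σ ^ 2 + V) * (K * (d * Real.log (1 + n * (V / σ ^ 2) / d))))
          ≤ n * y * ((σ ^ 2 + V) * (K * (d * ((1 + Real.log (1 + V / σ ^ 2)) * y)))) := by
            gcongr
        _ = D * y ^ 2 * (n * (d * K * s 1 ^ 2)) := by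
            simp only [D]
            field_simp
        _ ≤ _ := by
            gcongr
            exact le_add_of_nonneg_right hlat
    rw [pow_one, mul_assoc 2, mul_assoc 2]
    refine mul_le_mul_of_nonneg_left ((Real.sqrt_le_sqrt key).trans_eq ?_) zero_le_two
    rw [Real.sqrt_mul (by positivity), Real.sqrt_mul hD.le, Real.sqrt_sq hy]
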